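/- **Setting.** Let $X$ be a finite set of $n$ states, $\mathcal T\ge 1$ a time horizon, $A_0,\dots,A_{\mathcal T-1}\in\mathbb R_{\ge0}^{n\times n}$ row-stochastic matrices, $\pi\subseteq X$ a set of $k$ observed states, and $\rho_0,\dots,\rho_{\mathcal T}\in\mathbb R^k$. Let $C\in\{0,1\}^{k\times n}$ and $\overline C\in\{0,1\}^{(n-k)\times n}$ be the matrices that extract the observed and the unobserved coordinates. For nonnegative vectors or matrices $p,q$ of equal size with $\operatorname{supp}p\subseteq\operatorname{supp}q$ let $$\mathcal D(p\,|\,q)=\sum_i\Bigl(p_i\log\frac{p_i}{q_i}-p_i+q_i\Bigr),\qquad 0\log 0:=0,$$ and $\mathcal D(p\,|\,q)=+\infty$ otherwise. A sequence $M=(M_0,\dots,M_{\mathcal T-1})$ of matrices in $\mathbb R_{\ge0}^{n\times n}$ is called *feasible* if $$CM_t\mathbf 1=\rho_t\ (0\le t\le \mathcal T-1),\qquad CM_{\mathcal T-1}^\top\mathbf 1=\rho_{\mathcal T},\qquad M_t\mathbf 1=M_{t-1}^\top\mathbf 1\ (1\le t\le \mathcal T-1).$$ For $\mu\in\mathbb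 R^n$ put $$J_\mu(M)=\mathcal D\bigl(M_0\,|\,\operatorname{diag}(\mu)A_0\bigr)+\sum_{t=1}^{\mathcal T-1}\mathcal D\bigl(M_t\,|\,\operatorname{diag}(M_t\mathbf 1)A_t\bigr),$$ and for $\eta\in\mathbb R^{n-k}$ let $$f(\eta)=\inf\bigl\{J_{C^\top\rho_0+\overline C^\top\eta}(M)\;:\;M\text{ feasible},\ \overline CM_0\mathbf 1=\eta\bigr\}\in[0,+\infty],$$ with $\inf\emptyset=+\infty$. **Regularity assumption.** There is a feasible $M$ with $\sum_{t=0}^{\mathcal T-1}\mathcal D(M_t\,|\,\operatorname{diag}(M_t\mathbf 1)A_t)<\infty$ such that $(M_t)_{ij}>0$ whenever $(A_t)_{ij}>0$. **Proposition.** Suppose that the regularity assumption holds. 1. Let $\epsilon_0,\epsilon_1,\ldots>0$ and $x^0\in\mathbb R^{n-k}_{>0}$. The entropic proximal-point algorithm $$x^{j+1}\in\operatorname*{arg\,min}_{x\ge0}\bigl\{f(x)+\epsilon_j\,\mathcal D(x\,|\,x^{j})\bigr\},\qquad j=0,1,2,\dots,$$ started at $x^0$ is well defined: there is exactly one such sequence,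 and $x^j\in\mathbb R^{n-k}_{>0}$ for all $j$. If moreover $\sum_j 1/\epsilon_j=\infty$ (for example $\epsilon_j\equiv1$), then $x^j$ converges to some $\eta^\star$ with $f(\eta^\star)=\min_\eta f(\eta)<\infty$. 2. Let $\hat\eta\in\mathbb R^{n-k}_{>0}$. The problem of minimizing $J_{C^\top\rho_0+\overline C^\top\hat\eta}(M)$ over all feasible $M$ has exactly one solution $M^*$, and $$\operatorname*{arg\,min}_{\eta\ge0}\bigl\{f(\eta)+\mathcal D(\eta\,|\,\hat\eta)\bigr\}=\bigl\{\overline CM_0^*\mathbf 1\bigr\}.$$ -/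

import Mathlib

open Filter Topology Matrix

noncomputable section

namespace PartialBridge

/-- The normalized Kullback-Leibler divergence
`D(p | q) = ∑ i, (p i * log (p i / q i) - p i + q i)` of nonnegative vectors with
`supp p ⊆ supp q`, with `0 log 0 = 0`. Outside this domain the value is `+∞`. -/
def kl {ι : Type*} [Fintype ι] (p q : ι → ℝ) : EReal :=
  open Classical in
  if (∀ i, 0 ≤ p i) ∧ (∀ i, 0 ≤ q i) ∧ (∀ i, q i = 0 → p i = 0) then
    ((∑ i, (p i * Real.log (p i / q i) - p i + q i) : ℝ) : EReal)
  else ⊤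

/-- The Kullback-Leibler divergence of matrices, entrywise. -/
def klMat {ι κ : Type*} [Fintype ι] [Fintype κ] (P Q : Matrix ι κ ℝ) : EReal :=
  kl (fun a : ι × κ => P a.1 a.2) (fun a : ι × κ => Q a.1 a.2)

/-- The set of solutions of one step of the entropic proximal-point algorithm for `f`:
`argmin_{x ≥ 0} { f x + ε D(x | y) }`. -/
def entropicProx {ι : Type*} [Fintype ι] (f : (ι → ℝ) → EReal) (ε : ℝ) (y : ι → ℝ) :
    Set (ι → ℝ) :=
  {x | 0 ≤ x ∧ ∀ z, 0 ≤ z → f x + (ε : EReal) * kl x y ≤ f z + (ε : EReal) * kl z y}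

/-- `x` is a run of the entropic proximal-point algorithm for `f`, started at `x₀`, with
parameters `ε k`. -/
def IsProxSequence {ι : Type*} [Fintype ι] (f : (ι → ℝ) → EReal) (ε : ℕ → ℝ) (x₀ : ι → ℝ)
    (x : ℕ → ι → ℝ) : Prop :=
  x 0 = x₀ ∧ ∀ k, x (k + 1) ∈ entropicProx f (ε k) (x k)

variable {V : Type*} [Fintype V] [DecidableEq V]

/-- The 0-1 matrix `C` that extracts the observed states `S`. -/
def obsMatrix (S : Finset V) : Matrix {i // i ∈ S} V ℝ :=
  Matrix.of fun i j => if i.1 = j then 1 else 0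

/-- The 0-1 matrix `C̄` that extracts the unobserved states. -/
def unobsMatrix (S : Finset V) : Matrix {i // i ∉ S} V ℝ :=
  Matrix.of fun i j => if i.1 = j then 1 else 0

/-- The constraints of the bridge problem over the horizon `T = N + 1`: nonnegative transport
plans `M 0, …, M (T - 1)` that agree with the observations `ρ 0, …, ρ T` on the observed states
and conserve mass between consecutive time steps. -/
structure IsFeasible {N : ℕ} (S : Finset V) (ρ : Fin (N + 2) → {i // i ∈ S} → ℝ)
    (M : Fin (N + 1) → Matrix V V ℝ) : Prop where
  nonneg : ∀ t i j, 0 ≤ M t i j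
  obs : ∀ t : Fin (N + 1), obsMatrix S *ᵥ (M t *ᵥ 1) = ρ t.castSucc
  obs_last : obsMatrix S *ᵥ ((M (Fin.last N))ᵀ *ᵥ 1) = ρ (Fin.last (N + 1))
  matching : ∀ t : Fin N, M t.succ *ᵥ 1 = (M t.castSucc)ᵀ *ᵥ 1

/-- The objective `∑ t, D(M t | diag(M t 1) A t)` of the bridge problem with partially observed
initial state. -/
def primalCost {N : ℕ} (A M : Fin (N + 1) → Matrix V V ℝ) : EReal :=
  ∑ t, klMat (M t) (Matrix.diagonal (M t *ᵥ 1) * A t)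

/-- The regularity assumption: some feasible `M` (at which the objective is defined, that is,
finite) has `(M t) i j > 0` whenever `(A t) i j > 0`. -/
def Regular {N : ℕ} (A : Fin (N + 1) → Matrix V V ℝ) (S : Finset V)
    (ρ : Fin (N + 2) → {i // i ∈ S} → ℝ) : Prop :=
  ∃ M : Fin (N + 1) → Matrix V V ℝ, IsFeasible S ρ M ∧ primalCost A M ≠ ⊤ ∧
    ∀ t i j, 0 < A t i j → 0 < M t i j

/-- The full initial distribution `Cᵀ ρ₀ + C̄ᵀ η`. -/
def initMass (S : Finset V) (ρ₀ : {i // i ∈ S} → ℝ) (η : {i // i ∉ S} → ℝ) : V → ℝ :=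
  (obsMatrix S)ᵀ *ᵥ ρ₀ + (unobsMatrix S)ᵀ *ᵥ η

/-- The unobserved part `C̄ M₀ 1` of the initial distribution of `M`. -/
def unobsInit {N : ℕ} (S : Finset V) (M : Fin (N + 1) → Matrix V V ℝ) : {i // i ∉ S} → ℝ :=
  unobsMatrix S *ᵥ (M 0 *ᵥ 1)

/-- The objective `D(M 0 | diag(μ) A 0) + ∑_{t = 1}^{T - 1} D(M t | diag(M t 1) A t)`, where the
prior of the first step is fixed by `μ`. -/
def bridgeCost {N : ℕ} (A : Fin (N + 1) → Matrix V V ℝ) (μ : V → ℝ)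
    (M : Fin (N + 1) → Matrix V V ℝ) : EReal :=
  klMat (M 0) (Matrix.diagonal μ * A 0) +
    ∑ t : Fin N, klMat (M t.succ) (Matrix.diagonal (M t.succ *ᵥ 1) * A t.succ)

/-- The value function `f η`: the optimal value of the bridge problem when the unobserved part of
the initial distribution is fixed to `η` (`+∞` if there is no such feasible plan). -/
def valueFun {N : ℕ} (A : Fin (N + 1) → Matrix V V ℝ) (S : Finset V)
    (ρ : Fin (N + 2) → {i // i ∈ S} → ℝ) (η : {i // i ∉ S} → ℝ) : EReal :=
  ⨅ (M : Fin (N + 1) → Matrix V V ℝ) (_ : IsFeasible S ρ M) (_ : unobsInit S M = η),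
    bridgeCost A (initMass S (ρ 0) η) M

/-- `M` solves the bridge problem with the fixed first prior `diag(Cᵀ ρ₀ + C̄ᵀ η̂) A 0`: it
minimizes the objective over all feasible plans. -/
def SolvesFixedPrior {N : ℕ} (A : Fin (N + 1) → Matrix V V ℝ) (S : Finset V)
    (ρ : Fin (N + 2) → {i // i ∈ S} → ℝ) (ηhat : {i // i ∉ S} → ℝ)
    (M : Fin (N + 1) → Matrix V V ℝ) : Prop :=
  IsFeasible S ρ M ∧ ∀ M' : Fin (N + 1) → Matrix V V ℝ, IsFeasible S ρ M' →
    bridgeCost A (initMass S (ρ 0) ηhat) M ≤ bridgeCost A (initMass S (ρ 0) ηhat) M'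

end PartialBridge

end

/-! ### Scalar and vector estimates for the Kullback-Leibler divergence. -/

noncomputable section
namespace PartialBridge

/-! Plans of finite cost are flows along the transitions of the chain; recorded together with their
time marginals they form a closed convex set `planSet`, on which the relative entropy `flowCost` is
convex, homogeneous of degree one and, because the rows of `A` sum to 1, continuous. The value
function is the minimum of `flowCost` over the fibers of the linear map `initProj`, so an entropic
proximal step for `f` lifts to the minimization of `G + ε D(L · | y)` over a convex set
(`IsFiberMin`, `proxObj`).

The lifted step is solvable because the divergence bounds the unobserved initial mass and hence all
of the flow. The exact convexity gap of the divergence (`klTerm_convexCombo`) turns minimality of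
`x` into an inequality along segments towards any `z`. It forces `L x > 0`, as the slope of the
divergence is infinite at the boundary; in the limit it becomes `three_point`, which gives
uniqueness and decrease of the divergence from every minimizer to the iterates. If `∑ 1 / ε`
diverges, the values reach the minimum, a cluster point is a minimizer, and monotonicity of the
divergence from it gives convergence of the whole sequence.

This needs a minimizer of `flowCost`, although `planSet` may be unbounded. Mass starting where the
observed states are out of reach can be deleted at no cost; the mass of the remaining flows is
controlled by cost plus observed mass, by compactness and homogeneity (`exists_mass_le`).

For the second part, the chain rule splits the cost with fixed prior into `flowCost` plus the
divergence of the initial marginal (`bridgeCost_eq`), so this problem is the lifted step with `ε =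
1`. Its minimizing plan is unique although `flowCost` is not strictly convex: the initial marginal
is unique, and equality in the log-sum inequality then propagates forward in time
(`eq_of_flowCost_add_ge`). -/

/-- One term `p log (p / q) - p + q` of the normalized Kullback-Leibler divergence. -/
def klTerm (p q : ℝ) : ℝ := p * Real.log (p / q) - p + q

@[simp] lemma klTerm_zero_left (q : ℝ) : klTerm 0 q = q := by simp [klTerm]

@[simp] lemma klTerm_self (p : ℝ) : klTerm p p = 0 := by
  rcases eq_or_ne p 0 with rfl | h <;> simp [klTerm, *]

/-- The Hellinger bound, which is `log u ≤ u - 1` at `u = √(q / p)`. Nonnegativity, definiteness and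
coercivity in either argument all follow from it. -/
lemma sq_sqrt_sub_sqrt_le_klTerm {p q : ℝ} (hp : 0 ≤ p) (hq : 0 ≤ q) (h : q = 0 → p = 0) :
    (√p - √q) ^ 2 ≤ klTerm p q := by
  rcases hp.eq_or_lt with rfl | hp'
  · simp [Real.sq_sqrt hq]
  have hq' : 0 < q := hq.lt_of_ne fun h0 => hp'.ne' (h h0.symm)
  obtain ⟨a, ha, rfl⟩ : ∃ a, 0 < a ∧ p = a ^ 2 :=
    ⟨√p, Real.sqrt_pos.2 hp', (Real.sq_sqrt hp).symm⟩
  obtain ⟨b, hb, rfl⟩ : ∃ b, 0 < b ∧ q = b ^ 2 :=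
    ⟨√q, Real.sqrt_pos.2 hq', (Real.sq_sqrt hq).symm⟩
  rw [Real.sqrt_sq ha.le, Real.sqrt_sq hb.le, klTerm]
  have h1 : Real.log (b / a) ≤ b / a - 1 := Real.log_le_sub_one_of_pos (by positivity)
  have h2 : Real.log (a ^ 2 / b ^ 2) = - (2 * Real.log (b / a)) := by
    rw [← div_pow, Real.log_pow, Real.log_div ha.ne' hb.ne', Real.log_div hb.ne' ha.ne']
    push_cast; ring
  have h3 : a ^ 2 * Real.log (b / a) ≤ a ^ 2 * (b / a - 1) := by gcongr
  have h4 : a ^ 2 * (b / a - 1) = a * b - a ^ 2 := by field_simp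
  rw [h2]
  nlinarith

lemma klTerm_nonneg {p q : ℝ} (hp : 0 ≤ p) (hq : 0 ≤ q) (h : q = 0 → p = 0) :
    0 ≤ klTerm p q :=
  (sq_nonneg _).trans (sq_sqrt_sub_sqrt_le_klTerm hp hq h)

lemma eq_of_klTerm_le_zero {p q : ℝ} (hp : 0 ≤ p) (hq : 0 ≤ q) (h : q = 0 → p = 0)
    (h0 : klTerm p q ≤ 0) : p = q := by
  have h1 := (sq_sqrt_sub_sqrt_le_klTerm hp hq h).trans h0
  have h2 : √p - √q = 0 := by nlinarith
  exact (Real.sqrt_inj hp hq).1 (by linarith)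

lemma left_le_of_klTerm_le {p q c : ℝ} (hp : 0 ≤ p) (hq : 0 ≤ q) (h : q = 0 → p = 0)
    (hc : klTerm p q ≤ c) : p ≤ 2 * q + 2 * c := by
  have h1 := (sq_sqrt_sub_sqrt_le_klTerm hp hq h).trans hc
  nlinarith [Real.sq_sqrt hp, Real.sq_sqrt hq, sq_nonneg (√p - 2 * √q)]

lemma right_le_of_klTerm_le {p q c : ℝ} (hp : 0 ≤ p) (hq : 0 ≤ q) (h : q = 0 → p = 0)
    (hc : klTerm p q ≤ c) : q ≤ 2 * p + 2 * c := by
  have h1 := (sq_sqrt_sub_sqrt_le_klTerm hp hq h).trans hc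
  nlinarith [Real.sq_sqrt hp, Real.sq_sqrt hq, sq_nonneg (2 * √p - √q)]

lemma klTerm_mul_mul (c p q : ℝ) : klTerm (c * p) (c * q) = c * klTerm p q := by
  rcases eq_or_ne c 0 with rfl | h
  · simp [klTerm]
  · rw [klTerm, klTerm, mul_div_mul_left _ _ h]; ring

lemma klTerm_eq_of_pos {p q : ℝ} (hq : q ≠ 0) :
    klTerm p q = p * Real.log p - p * Real.log q - p + q := by
  rcases eq_or_ne p 0 with rfl | hp
  · simp
  · rw [klTerm, Real.log_div hp hq]; ring

/-- Apart from the divergence itself, the correction is linear in `(p, q)`, so it cancels in the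
log-sum inequality. -/
lemma klTerm_scale {p q s : ℝ} (hs : 0 < s) (h : q = 0 → p = 0) :
    klTerm p q = klTerm p (s * q) + p * Real.log s + q - s * q := by
  rcases eq_or_ne q 0 with rfl | hq
  · simp [h rfl]
  · rw [klTerm_eq_of_pos hq, klTerm_eq_of_pos (mul_ne_zero hs.ne' hq),
      Real.log_mul hs.ne' hq]
    ring

/-- The log-sum inequality. -/
lemma klTerm_add_le {a b c e : ℝ} (ha : 0 ≤ a) (hb : 0 ≤ b) (hc : 0 ≤ c) (he : 0 ≤ e)
    (hac : c = 0 → a = 0) (hbe : e = 0 → b = 0) :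
    klTerm (a + b) (c + e) ≤ klTerm a c + klTerm b e := by
  rcases (add_nonneg ha hb).eq_or_lt with h | h
  · obtain rfl : a = 0 := by linarith
    obtain rfl : b = 0 := by linarith
    simp
  have hce : 0 < c + e := by
    refine (add_nonneg hc he).lt_of_ne fun h0 => h.ne' ?_
    rw [hac (by linarith), hbe (by linarith), add_zero]
  -- Scaling by this factor matches the totals, so the divergence of the sums vanishes and the two
  -- scaled terms are the nonnegative defect.
  have hs : 0 < (a + b) / (c + e) := by positivity
  have h1 : (a + b) / (c + e) * (c + e) = a + b := by field_simp
  have e1 := klTerm_scale hs hac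
  have e2 := klTerm_scale hs hbe
  have e3 := klTerm_scale (p := a + b) (q := c + e) hs fun h0 => absurd h0 hce.ne'
  rw [h1, klTerm_self] at e3
  have n1 : 0 ≤ klTerm a ((a + b) / (c + e) * c) :=
    klTerm_nonneg ha (by positivity) fun h0 => hac (by simpa [hs.ne'] using h0)
  have n2 : 0 ≤ klTerm b ((a + b) / (c + e) * e) :=
    klTerm_nonneg hb (by positivity) fun h0 => hbe (by simpa [hs.ne'] using h0)
  rw [e1, e2, e3]
  nlinarith

/-- The convexity gap of the divergence in its first argument. -/
lemma klTerm_convexCombo {x z y s : ℝ} (hx : 0 ≤ x) (hz : 0 ≤ z) (hs : 0 < s) (hs1 : s < 1)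
    (hxy : y = 0 → x = 0) (hzy : y = 0 → z = 0) :
    (1 - s) * klTerm x y + s * klTerm z y =
      klTerm ((1 - s) * x + s * z) y + (1 - s) * klTerm x ((1 - s) * x + s * z) +
        s * klTerm z ((1 - s) * x + s * z) := by
  have hs' : 0 < 1 - s := by linarith
  rcases eq_or_ne y 0 with rfl | hy
  · simp [hxy rfl, hzy rfl]
  have a1 : 0 ≤ (1 - s) * x := by positivity
  have a2 : 0 ≤ s * z := by positivity
  rcases (add_nonneg a1 a2).eq_or_lt with h | h
  · obtain rfl : x = 0 := by
      have : (1 - s) * x = 0 := by linarith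
      simpa [hs'.ne'] using this
    obtain rfl : z = 0 := by
      have : s * z = 0 := by linarith
      simpa [hs.ne'] using this
    simp; ring
  · rw [klTerm_eq_of_pos (p := x) hy, klTerm_eq_of_pos (p := z) hy, klTerm_eq_of_pos hy,
      klTerm_eq_of_pos h.ne', klTerm_eq_of_pos h.ne']
    ring

lemma continuous_klTerm_left (q : ℝ) : Continuous fun p => klTerm p q := by
  rcases eq_or_ne q 0 with rfl | hq
  · simp only [klTerm, div_zero, Real.log_zero, mul_zero]; fun_prop
  · simp only [klTerm_eq_of_pos hq]
    have := Real.continuous_mul_log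
    fun_prop

lemma continuousAt_klTerm_right {p q : ℝ} (h : q = 0 → p = 0) : ContinuousAt (klTerm p) q := by
  rcases eq_or_ne p 0 with rfl | hp
  · simp only [funext klTerm_zero_left]; exact continuousAt_id
  · have hq : q ≠ 0 := fun h0 => hp (h h0)
    unfold klTerm
    have h1 : p / q ≠ 0 := div_ne_zero hp hq
    fun_prop (disch := assumption)

variable {ι : Type*} [Fintype ι]

/-- The real-valued Kullback-Leibler divergence of vectors. -/
def klVec (p q : ι → ℝ) : ℝ := ∑ i, klTerm (p i) (q i)

lemma klVec_nonneg {p q : ι → ℝ} (hp : 0 ≤ p) (hq : 0 ≤ q) (h : ∀ i, q i = 0 → p i = 0) :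
    0 ≤ klVec p q :=
  Finset.sum_nonneg fun i _ => klTerm_nonneg (hp i) (hq i) (h i)

lemma klTerm_le_klVec {p q : ι → ℝ} (hp : 0 ≤ p) (hq : 0 ≤ q) (h : ∀ i, q i = 0 → p i = 0)
    (i : ι) : klTerm (p i) (q i) ≤ klVec p q :=
  Finset.single_le_sum (f := fun i => klTerm (p i) (q i))
    (fun i _ => klTerm_nonneg (hp i) (hq i) (h i)) (Finset.mem_univ i)

@[simp] lemma klVec_self (p : ι → ℝ) : klVec p p = 0 := by simp [klVec]

lemma eq_of_klVec_le_zero {p q : ι → ℝ} (hp : 0 ≤ p) (hq : 0 ≤ q) (h : ∀ i, q i = 0 → p i = 0)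
    (h0 : klVec p q ≤ 0) : p = q :=
  funext fun i => eq_of_klTerm_le_zero (hp i) (hq i) (h i) ((klTerm_le_klVec hp hq h i).trans h0)

lemma kl_eq_klVec {p q : ι → ℝ} (hp : 0 ≤ p) (hq : 0 ≤ q) (h : ∀ i, q i = 0 → p i = 0) :
    kl p q = (klVec p q : ℝ) := by
  rw [kl, if_pos ⟨hp, hq, h⟩]; rfl

lemma klVec_convexCombo {x z y : ι → ℝ} {s : ℝ} (hx : 0 ≤ x) (hz : 0 ≤ z) (hs : 0 < s)
    (hs1 : s < 1) (hxy : ∀ i, y i = 0 → x i = 0) (hzy : ∀ i, y i = 0 → z i = 0) :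
    (1 - s) * klVec x y + s * klVec z y =
      klVec ((1 - s) • x + s • z) y + (1 - s) * klVec x ((1 - s) • x + s • z) +
        s * klVec z ((1 - s) • x + s • z) := by
  simp only [klVec, Finset.mul_sum, ← Finset.sum_add_distrib]
  exact Finset.sum_congr rfl fun i _ => klTerm_convexCombo (hx i) (hz i) hs hs1 (hxy i) (hzy i)

lemma continuous_klVec_left (q : ι → ℝ) : Continuous fun p => klVec p q :=
  continuous_finsetSum _ fun i _ => (continuous_klTerm_left (q i)).comp (continuous_apply i)

lemma continuousAt_klVec_right {p q : ι → ℝ} (h : ∀ i, q i = 0 → p i = 0) :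
    ContinuousAt (klVec p) q := by
  unfold klVec
  refine tendsto_finsetSum _ fun i _ => ?_
  exact (continuousAt_klTerm_right (h i)).comp (f := fun q : ι → ℝ => q i)
    (continuous_apply i).continuousAt

/-- Convergence in Kullback-Leibler divergence implies convergence. -/
lemma tendsto_of_klVec_tendsto_zero {p : ι → ℝ} {x : ℕ → ι → ℝ} (hp : 0 ≤ p)
    (hx : ∀ k i, 0 < x k i) (h : Tendsto (fun k => klVec p (x k)) atTop (𝓝 0)) :
    Tendsto x atTop (𝓝 p) := by
  rw [tendsto_pi_nhds]
  intro i
  -- The Hellinger bound gives convergence of the square roots.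
  have h1 : Tendsto (fun k => (√(p i) - √(x k i)) ^ 2) atTop (𝓝 0) :=
    squeeze_zero (fun _ => sq_nonneg _) (fun k =>
      (sq_sqrt_sub_sqrt_le_klTerm (hp i) (hx k i).le fun h0 => absurd h0 (hx k i).ne').trans
        (klTerm_le_klVec hp (fun i => (hx k i).le) (fun i h0 => absurd h0 (hx k i).ne') i)) h
  have h2 : Tendsto (fun k => |√(p i) - √(x k i)|) atTop (𝓝 0) := by
    have := (Real.continuous_sqrt.tendsto 0).comp h1
    simpa [Function.comp_def, Real.sqrt_sq_eq_abs] using this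
  have h3 : Tendsto (fun k => √(p i) - (√(p i) - √(x k i))) atTop (𝓝 (√(p i) - 0)) :=
    tendsto_const_nhds.sub ((tendsto_zero_iff_abs_tendsto_zero _).2 h2)
  have h4 := h3.pow 2
  simp only [sub_sub_cancel, sub_zero] at h4
  simpa [Real.sq_sqrt (hp i), fun k => Real.sq_sqrt (hx k i).le] using h4

end PartialBridge
end

/-! ### The entropic proximal-point algorithm for a fiberwise minimum. -/

noncomputable section
namespace PartialBridge

variable {E ι : Type*} [Fintype ι] [NormedAddCommGroup E] [NormedSpace ℝ E]

/-- `f η` is the minimum of the convex continuous function `G` over the fiber `L x = η` in the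
convex set `K`, on which the sublevel sets of the nonnegative map `L` are compact. -/
structure IsFiberMin (K : Set E) (G : E → ℝ) (L : E →L[ℝ] (ι → ℝ)) (f : (ι → ℝ) → EReal) :
    Prop where
  isCompact : ∀ R : ℝ, IsCompact {x ∈ K | ∀ i, L x i ≤ R}
  convexOn : ConvexOn ℝ K G
  continuousOn : ContinuousOn G K
  nonneg : ∀ x ∈ K, 0 ≤ G x
  map_nonneg : ∀ x ∈ K, 0 ≤ L x
  exists_pos : ∃ x ∈ K, ∀ i, 0 < L x i
  le : ∀ x ∈ K, f (L x) ≤ G x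
  attained : ∀ η, f η ≠ ⊤ → ∃ x ∈ K, L x = η ∧ f η = G x

/-- The objective of one entropic proximal step, lifted along `L`. -/
def proxObj (G : E → ℝ) (L : E →L[ℝ] (ι → ℝ)) (ε : ℝ) (y : ι → ℝ) (x : E) : ℝ :=
  G x + ε * klVec (L x) y

namespace IsFiberMin

variable {K : Set E} {G : E → ℝ} {L : E →L[ℝ] (ι → ℝ)} {f : (ι → ℝ) → EReal}
  {ε : ℝ} {y : ι → ℝ}

omit [Fintype ι] in
lemma combo_mem (H : IsFiberMin K G L f) {x z : E} (hx : x ∈ K) (hz : z ∈ K) {s : ℝ}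
    (hs : 0 < s) (hs1 : s < 1) : (1 - s) • x + s • z ∈ K :=
  H.convexOn.1 hx hz (by linarith) hs.le (by ring)

/-- Since `G ≥ 0`, a bound on the objective bounds the divergence and thus `L x`, so the search is
confined to a compact set. -/
lemma exists_isMinOn (H : IsFiberMin K G L f) (hε : 0 < ε) (hy : ∀ i, 0 < y i) :
    ∃ x ∈ K, IsMinOn (proxObj G L ε y) K x := by
  obtain ⟨x₀, hx₀, -⟩ := H.exists_pos
  set c := proxObj G L ε y x₀
  set R : ℝ := ∑ i, 2 * y i + 2 * (c / ε)
  have hbd : ∀ x ∈ K, proxObj G L ε y x ≤ c → ∀ i, L x i ≤ R := by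
    intro x hx hxc i
    have h1 : klVec (L x) y ≤ c / ε := by
      rw [le_div_iff₀' hε]
      have := H.nonneg x hx
      unfold proxObj at hxc
      linarith
    have h2 := left_le_of_klTerm_le (H.map_nonneg x hx i) (hy i).le
      (fun h0 => absurd h0 (hy i).ne')
      ((klTerm_le_klVec (H.map_nonneg x hx) (fun i => (hy i).le)
        (fun i h0 => absurd h0 (hy i).ne') i).trans h1)
    have h3 : 2 * y i ≤ ∑ i, 2 * y i :=
      Finset.single_le_sum (f := fun i => 2 * y i) (fun i _ => by have := hy i; positivity)
        (Finset.mem_univ i)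
    linarith
  have hcont : ContinuousOn (proxObj G L ε y) K :=
    H.continuousOn.add (((continuous_klVec_left y).comp L.continuous).const_mul ε |>.continuousOn)
  obtain ⟨x, ⟨hxK, _⟩, hmin⟩ := (H.isCompact R).exists_isMinOn ⟨x₀, hx₀, hbd x₀ hx₀ le_rfl⟩
    (hcont.mono fun x hx => hx.1)
  refine ⟨x, hxK, fun z hz => ?_⟩
  by_cases hzc : proxObj G L ε y z ≤ c
  · exact hmin ⟨hz, hbd z hz hzc⟩
  · have h1 : proxObj G L ε y x ≤ c := hmin ⟨hx₀, hbd x₀ hx₀ le_rfl⟩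
    exact h1.trans (not_le.1 hzc).le

/-- Compare `x` with the point at parameter `s` on the segment to `z`, insert the exact convexity
gap, drop the term of `x` and divide by `s`. No differentiability is needed. -/
lemma proxObj_add_le (H : IsFiberMin K G L f) (hε : 0 < ε) (hy : ∀ i, 0 < y i) {x z : E}
    (hx : x ∈ K) (hmin : IsMinOn (proxObj G L ε y) K x) (hz : z ∈ K) {s : ℝ} (hs : 0 < s)
    (hs1 : s < 1) :
    proxObj G L ε y x + ε * klVec (L z) ((1 - s) • L x + s • L z) ≤ proxObj G L ε y z := by
  have h1 : proxObj G L ε y x ≤ proxObj G L ε y ((1 - s) • x + s • z) :=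
    hmin (H.combo_mem hx hz hs hs1)
  have h2 := H.convexOn.2 hx hz (by linarith : (0 : ℝ) ≤ 1 - s) hs.le (by ring)
  have h3 := klVec_convexCombo (y := y) (H.map_nonneg x hx) (H.map_nonneg z hz) hs hs1
    (fun i h0 => absurd h0 (hy i).ne') (fun i h0 => absurd h0 (hy i).ne')
  have h4 : 0 ≤ klVec (L x) ((1 - s) • L x + s • L z) := by
    refine klVec_nonneg (H.map_nonneg x hx) ?_ fun i h0 => ?_
    · have := H.map_nonneg _ (H.combo_mem hx hz hs hs1)
      simpa using this
    · have a1 := H.map_nonneg x hx i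
      have a2 := H.map_nonneg z hz i
      simp only [Pi.add_apply, Pi.smul_apply, smul_eq_mul, Pi.zero_apply] at h0 a1 a2
      nlinarith
  simp only [proxObj, map_add, map_smul, smul_eq_mul] at h1 h2 ⊢
  have h5 : 0 ≤ ε * ((1 - s) * klVec (L x) ((1 - s) • L x + s • L z)) :=
    mul_nonneg hε.le (mul_nonneg (by linarith) h4)
  have h6 : ε * ((1 - s) * klVec (L x) y + s * klVec (L z) y) = _ := congrArg (ε * ·) h3
  refine le_of_mul_le_mul_left ?_ hs
  linarith

/-- If `L x i = 0`, the segment point has coordinate `s * L z i`, and the gap term grows like `L z i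
* log (1 / s)`, against a bound independent of `s`. -/
lemma map_pos (H : IsFiberMin K G L f) (hε : 0 < ε) (hy : ∀ i, 0 < y i) {x : E}
    (hx : x ∈ K) (hmin : IsMinOn (proxObj G L ε y) K x) (i : ι) : 0 < L x i := by
  refine (H.map_nonneg x hx i).lt_of_ne fun h0 => ?_
  simp only [Pi.zero_apply] at h0
  obtain ⟨z, hz, hzpos⟩ := H.exists_pos
  have key : ∀ s : ℝ, 0 < s → s < 1 →
      L z i * Real.log s⁻¹ ≤ (proxObj G L ε y z - proxObj G L ε y x) / ε + L z i := by
    intro s hs hs1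
    have h1 := H.proxObj_add_le hε hy hx hmin hz hs hs1
    have hpos : ∀ j, 0 < ((1 - s) • L x + s • L z) j := fun j => by
      have a1 : 0 ≤ (1 - s) * L x j := mul_nonneg (by linarith) (H.map_nonneg x hx j)
      have a2 : 0 < s * L z j := mul_pos hs (hzpos j)
      simpa using add_pos_of_nonneg_of_pos a1 a2
    have h2 := klTerm_le_klVec (p := L z) (H.map_nonneg z hz) (fun j => (hpos j).le)
      (fun j h => absurd h (hpos j).ne') i
    have h3 : klVec (L z) ((1 - s) • L x + s • L z) ≤
        (proxObj G L ε y z - proxObj G L ε y x) / ε := by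
      rw [le_div_iff₀' hε]; linarith
    have h4 : L z i / (s * L z i) = s⁻¹ := by
      have := (hzpos i).ne'
      field_simp
    simp only [Pi.add_apply, Pi.smul_apply, smul_eq_mul, ← h0, mul_zero, zero_add, klTerm,
      h4] at h2
    have := mul_pos hs (hzpos i)
    linarith
  set B := (proxObj G L ε y z - proxObj G L ε y x) / ε + L z i
  -- With this `s` the left side of `key` equals `|B| + L z i`, which exceeds `B`.
  have h1 := key (Real.exp (-(|B| / L z i + 1))) (Real.exp_pos _) (by
    rw [Real.exp_lt_one_iff]
    have := div_nonneg (abs_nonneg B) (hzpos i).le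
    linarith)
  rw [← Real.exp_neg, Real.log_exp, neg_neg, mul_add, mul_div_cancel₀ _ (hzpos i).ne'] at h1
  linarith [le_abs_self B, hzpos i]

/-- The three-point inequality of the entropic proximal step. -/
lemma three_point (H : IsFiberMin K G L f) (hε : 0 < ε) (hy : ∀ i, 0 < y i) {x z : E}
    (hx : x ∈ K) (hmin : IsMinOn (proxObj G L ε y) K x) (hz : z ∈ K) :
    proxObj G L ε y x + ε * klVec (L z) (L x) ≤ proxObj G L ε y z := by
  have h1 : Tendsto (fun s : ℝ => klVec (L z) ((1 - s) • L x + s • L z)) (𝓝[>] 0)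
      (𝓝 (klVec (L z) (L x))) := by
    have h2 := continuousAt_klVec_right (p := L z) (q := L x)
      fun i h0 => absurd h0 (H.map_pos hε hy hx hmin i).ne'
    have h3 : Tendsto (fun s : ℝ => (1 - s) • L x + s • L z) (𝓝[>] 0) (𝓝 (L x)) := by
      have : Continuous fun s : ℝ => (1 - s) • L x + s • L z := by fun_prop
      simpa using (this.tendsto 0).mono_left nhdsWithin_le_nhds
    exact h2.tendsto.comp h3
  refine le_of_tendsto ((h1.const_mul ε).const_add _) ?_
  filter_upwards [Ioo_mem_nhdsGT (zero_lt_one' ℝ)] with s hs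
  exact H.proxObj_add_le hε hy hx hmin hz hs.1 hs.2

lemma map_eq (H : IsFiberMin K G L f) (hε : 0 < ε) (hy : ∀ i, 0 < y i) {x z : E}
    (hx : x ∈ K) (hmin : IsMinOn (proxObj G L ε y) K x) (hz : z ∈ K)
    (hmin' : IsMinOn (proxObj G L ε y) K z) : L z = L x := by
  have h1 := H.three_point hε hy hx hmin hz
  have h2 : proxObj G L ε y z ≤ proxObj G L ε y x := hmin' hx
  refine eq_of_klVec_le_zero (H.map_nonneg z hz) (H.map_nonneg x hx)
    (fun i h0 => absurd h0 (H.map_pos hε hy hx hmin i).ne') ?_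
  by_contra h3
  nlinarith [mul_pos hε (not_le.1 h3)]

lemma obj_eq (hy : ∀ i, 0 < y i) {η : ι → ℝ} (hη : 0 ≤ η) (r : ℝ) :
    (r : EReal) + (ε : EReal) * kl η y = ((r + ε * klVec η y : ℝ) : EReal) := by
  rw [kl_eq_klVec hη (fun i => (hy i).le) fun i h0 => absurd h0 (hy i).ne']
  norm_cast

/-- The divergence term depends only on `L x`, so minimizing over `η` and then in the fiber is
minimizing over `K`; points with `f = ⊤` never compete. -/
lemma mem_entropicProx_iff (H : IsFiberMin K G L f) (hy : ∀ i, 0 < y i)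
    {η : ι → ℝ} : η ∈ entropicProx f ε y ↔
      ∃ x ∈ K, L x = η ∧ f η = G x ∧ IsMinOn (proxObj G L ε y) K x := by
  constructor
  · rintro ⟨hη, hmin⟩
    obtain ⟨x₀, hx₀, -⟩ := H.exists_pos
    have key : ∀ z ∈ K, f η + (ε : EReal) * kl η y ≤ (proxObj G L ε y z : ℝ) := by
      intro z hz
      refine (hmin _ (H.map_nonneg z hz)).trans ?_
      rw [proxObj, ← obj_eq hy (H.map_nonneg z hz)]
      gcongr
      exact H.le z hz
    have hfin : f η ≠ ⊤ := by
      intro h0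
      have := key x₀ hx₀
      rw [h0, kl_eq_klVec hη (fun i => (hy i).le) fun i h0 => absurd h0 (hy i).ne',
        ← EReal.coe_mul, EReal.top_add_coe] at this
      exact EReal.coe_ne_top _ (top_le_iff.1 this)
    obtain ⟨x, hx, rfl, hfx⟩ := H.attained η hfin
    refine ⟨x, hx, rfl, hfx, fun z hz => ?_⟩
    have := key z hz
    rw [hfx, obj_eq hy hη] at this
    exact_mod_cast this
  · rintro ⟨x, hx, rfl, hfx, hmin⟩
    refine ⟨H.map_nonneg x hx, fun z hz => ?_⟩
    by_cases hfz : f z = ⊤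
    · rw [hfz, kl_eq_klVec hz (fun i => (hy i).le) fun i h0 => absurd h0 (hy i).ne',
        ← EReal.coe_mul, EReal.top_add_coe]
      exact le_top
    · obtain ⟨w, hw, rfl, hfw⟩ := H.attained z hfz
      rw [hfx, hfw, obj_eq hy hz, obj_eq hy (H.map_nonneg x hx)]
      exact_mod_cast (hmin hw : proxObj G L ε y x ≤ proxObj G L ε y w)

lemma existsUnique_step (H : IsFiberMin K G L f) (hε : 0 < ε) (hy : ∀ i, 0 < y i) :
    ∃! η, η ∈ entropicProx f ε y := by
  -- `H` does not say directly that `f (L x) = G x`, so `x` is replaced by a point `w` of its fiber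
  -- at which `f` is attained.
  obtain ⟨x, hx, hmin⟩ := H.exists_isMinOn hε hy
  obtain ⟨w, hw, hwx, hfw⟩ := H.attained (L x)
    (ne_top_of_le_ne_top (EReal.coe_ne_top _) (H.le x hx))
  have hle : G w ≤ G x := by
    have := H.le x hx
    rw [hfw] at this
    exact_mod_cast this
  have hminw : IsMinOn (proxObj G L ε y) K w := fun z hz => by
    have h1 : proxObj G L ε y x ≤ proxObj G L ε y z := hmin hz
    refine le_trans ?_ h1
    rw [proxObj, proxObj, hwx]
    linarith
  refine ⟨L x, (H.mem_entropicProx_iff hy).2 ⟨w, hw, hwx, hfw, hminw⟩, fun η hη => ?_⟩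
  obtain ⟨v, hv, rfl, -, hminv⟩ := (H.mem_entropicProx_iff hy).1 hη
  exact H.map_eq hε hy hx hmin hv hminv

lemma step_pos (H : IsFiberMin K G L f) (hε : 0 < ε) (hy : ∀ i, 0 < y i) {η : ι → ℝ}
    (hη : η ∈ entropicProx f ε y) (i : ι) : 0 < η i := by
  obtain ⟨v, hv, rfl, -, hminv⟩ := (H.mem_entropicProx_iff hy).1 hη
  exact H.map_pos hε hy hv hminv i

lemma proxSequence_pos (H : IsFiberMin K G L f) {ε : ℕ → ℝ} {x₀ : ι → ℝ} (hε : ∀ k, 0 < ε k)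
    (h₀ : ∀ i, 0 < x₀ i) {x : ℕ → ι → ℝ} (hx : IsProxSequence f ε x₀ x) (k : ℕ) (i : ι) :
    0 < x k i := by
  induction k generalizing i with
  | zero => rw [hx.1]; exact h₀ i
  | succ k ih => exact H.step_pos (hε k) ih (hx.2 k) i

lemma existsUnique_proxSequence (H : IsFiberMin K G L f) {ε : ℕ → ℝ} {x₀ : ι → ℝ}
    (hε : ∀ k, 0 < ε k) (h₀ : ∀ i, 0 < x₀ i) : ∃! x, IsProxSequence f ε x₀ x := by
  choose T hT hTu using fun (k : ℕ) (y : {y : ι → ℝ // ∀ i, 0 < y i}) =>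
    H.existsUnique_step (hε k) y.2
  -- The recursion runs in the positive vectors, where the step is defined and which it preserves.
  let u : ℕ → {y : ι → ℝ // ∀ i, 0 < y i} := fun k =>
    Nat.rec ⟨x₀, h₀⟩ (fun k y => ⟨T k y, H.step_pos (hε k) y.2 (hT k y)⟩) k
  refine ⟨fun k => (u k).1, ⟨rfl, fun k => hT k (u k)⟩, fun x hx => funext fun k => ?_⟩
  induction k with
  | zero => exact hx.1
  | succ k ih =>
    refine hTu k (u k) _ ?_
    have := hx.2 k
    rwa [ih] at this

/-- Convergence of the entropic proximal-point algorithm to a minimizer. -/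
theorem tendsto_proxSequence (H : IsFiberMin K G L f) {ε : ℕ → ℝ} {x₀ : ι → ℝ}
    (hε : ∀ k, 0 < ε k) (h₀ : ∀ i, 0 < x₀ i) (hex : ∃ z ∈ K, IsMinOn G K z) {x : ℕ → ι → ℝ}
    (hx : IsProxSequence f ε x₀ x) (hsum : ¬ Summable fun k => 1 / ε k) :
    ∃ η, f η ≠ ⊤ ∧ (∀ η', f η ≤ f η') ∧ Tendsto x atTop (𝓝 η) := by
  have hpos := H.proxSequence_pos hε h₀ hx
  -- Index shift: `w k` lifts `x (k + 1)`.
  choose w hw hwL _ hwmin using fun k => (H.mem_entropicProx_iff (hpos k)).1 (hx.2 k)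
  have h3 : ∀ k, ∀ z ∈ K, G (w k) + ε k * klVec (L z) (x (k + 1)) ≤
      G z + ε k * klVec (L z) (x k) := by
    intro k z hz
    have h1 := H.three_point (hε k) (hpos k) (hw k) (hwmin k) hz
    rw [hwL] at h1
    have h2 : 0 ≤ klVec (x (k + 1)) (x k) := klVec_nonneg (fun i => (hpos _ i).le)
      (fun i => (hpos _ i).le) fun i h => absurd h (hpos _ i).ne'
    simp only [proxObj, hwL] at h1
    nlinarith [mul_nonneg (hε k).le h2]
  have hnn : ∀ z ∈ K, ∀ k, 0 ≤ klVec (L z) (x k) := fun z hz k =>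
    klVec_nonneg (H.map_nonneg z hz) (fun i => (hpos _ i).le) fun i h => absurd h (hpos _ i).ne'
  have hGanti : Antitone fun k => G (w k) := antitone_nat_of_succ_le fun k => by
    have h1 := h3 (k + 1) (w k) (hw k)
    rw [hwL, klVec_self, mul_zero, add_zero] at h1
    have h2 := mul_nonneg (hε (k + 1)).le (hnn (w k) (hw k) (k + 1 + 1))
    rw [hwL] at h2
    linarith
  have hdesc : ∀ z ∈ K, IsMinOn G K z → ∀ k,
      klVec (L z) (x (k + 1)) + (G (w k) - G z) * (1 / ε k) ≤ klVec (L z) (x k) := by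
    intro z hz hzmin k
    have h1 := h3 k z hz
    have h4 : (G (w k) - G z) * (1 / ε k) ≤ klVec (L z) (x k) - klVec (L z) (x (k + 1)) := by
      rw [mul_one_div, div_le_iff₀ (hε k)]
      linarith
    linarith
  have hanti : ∀ z ∈ K, IsMinOn G K z → Antitone fun k => klVec (L z) (x k) :=
    fun z hz hzmin => antitone_nat_of_succ_le fun k => by
      have h1 := hdesc z hz hzmin k
      have h2 : G z ≤ G (w k) := hzmin (hw k)
      have h4 : 0 ≤ (G (w k) - G z) * (1 / ε k) :=
        mul_nonneg (by linarith) (one_div_pos.2 (hε k)).le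
      linarith
  obtain ⟨z, hz, hzmin⟩ := hex
  have hGlim : Tendsto (fun k => G (w k)) atTop (𝓝 (G z)) := by
    rw [Metric.tendsto_atTop]
    intro δ hδ
    obtain ⟨k, hk⟩ : ∃ k, G (w k) < G z + δ := by
      by_contra! hcon
      -- If the excess stayed at least `δ`, telescoping `hdesc` would bound the partial sums of `1 /
      -- ε`.
      refine hsum (summable_of_sum_range_le (c := klVec (L z) (x 0) / δ)
        (fun k => (one_div_pos.2 (hε k)).le) fun n => ?_)
      have h1 : ∀ n, klVec (L z) (x n) + δ * ∑ k ∈ Finset.range n, 1 / ε k ≤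
          klVec (L z) (x 0) := by
        intro n
        induction n with
        | zero => simp
        | succ n ih =>
          rw [Finset.sum_range_succ, mul_add]
          have h2 := hdesc z hz hzmin n
          have h4 : δ * (1 / ε n) ≤ (G (w n) - G z) * (1 / ε n) :=
            mul_le_mul_of_nonneg_right (by linarith [hcon n]) (one_div_pos.2 (hε n)).le
          linarith
      rw [le_div_iff₀' hδ]
      linarith [h1 n, hnn z hz n]
    refine ⟨k, fun n hn => ?_⟩
    have h1 : G z ≤ G (w n) := hzmin (hw n)
    have h2 : G (w n) ≤ G (w k) := hGanti hn
    rw [Real.dist_eq, abs_lt]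
    constructor <;> linarith
  set R : ℝ := ∑ i, 2 * L z i + 2 * klVec (L z) (x 0)
  have hmem : ∀ k, w k ∈ {x ∈ K | ∀ i, L x i ≤ R} := by
    refine fun k => ⟨hw k, fun i => ?_⟩
    have h1 := klTerm_le_klVec (H.map_nonneg z hz) (fun i => (hpos (k + 1) i).le)
      (fun i h => absurd h (hpos _ i).ne') i
    have h2 := right_le_of_klTerm_le (H.map_nonneg z hz i) (hpos (k + 1) i).le
      (fun h => absurd h (hpos _ i).ne') (h1.trans (hanti z hz hzmin (Nat.zero_le (k + 1))))
    have h4 : 2 * L z i ≤ ∑ i, 2 * L z i :=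
      Finset.single_le_sum (f := fun i => 2 * L z i)
        (fun i _ => mul_nonneg zero_le_two (H.map_nonneg z hz i)) (Finset.mem_univ i)
    rw [hwL]
    linarith
  obtain ⟨v, ⟨hv, -⟩, φ, hφ, hlim⟩ := (H.isCompact R).tendsto_subseq hmem
  have hGv : G v = G z := by
    have h1 : Tendsto (G ∘ w ∘ φ) atTop (𝓝 (G v)) :=
      (H.continuousOn v hv).tendsto.comp
        (tendsto_nhdsWithin_iff.2 ⟨hlim, Eventually.of_forall fun k => hw _⟩)
    exact tendsto_nhds_unique h1 (hGlim.comp hφ.tendsto_atTop)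
  have hvmin : IsMinOn G K v := fun u hu => by
    have : G z ≤ G u := hzmin hu
    simpa [hGv] using this
  refine ⟨L v, ne_top_of_le_ne_top (EReal.coe_ne_top _) (H.le v hv), fun η' => ?_, ?_⟩
  · by_cases hη : f η' = ⊤
    · rw [hη]; exact le_top
    · obtain ⟨u, hu, rfl, hfu⟩ := H.attained η' hη
      rw [hfu]
      exact (H.le v hv).trans (by exact_mod_cast (hvmin hu : G v ≤ G u))
  · refine tendsto_of_klVec_tendsto_zero (H.map_nonneg v hv) hpos ?_
    -- The divergence from the cluster point is monotone, hence convergent, and its limit is read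
    -- off along the subsequence.
    have h1 := tendsto_atTop_ciInf (hanti v hv hvmin)
      ⟨0, by rintro _ ⟨k, rfl⟩; exact hnn v hv k⟩
    have h2 : Tendsto (fun k => klVec (L v) (x (φ k + 1))) atTop (𝓝 0) := by
      have h4 : Tendsto (fun k => x (φ k + 1)) atTop (𝓝 (L v)) := by
        simpa [Function.comp_def, hwL] using (L.continuous.tendsto v).comp hlim
      simpa [Function.comp_def] using
        (continuousAt_klVec_right (p := L v) (q := L v) fun _ h => h).tendsto.comp h4
    have h5 : Tendsto (fun k => φ k + 1) atTop atTop :=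
      (tendsto_add_atTop_nat 1).comp hφ.tendsto_atTop
    rwa [tendsto_nhds_unique (h1.comp h5) h2] at h1

end IsFiberMin
end PartialBridge
end

/-! ### Flows with marginals: compactness, convexity and existence of a minimum. -/

noncomputable section
namespace PartialBridge

variable {V : Type*} [Fintype V] {N : ℕ}

/-- Families of transport plans together with their time marginals. -/
abbrev FlowSpace (N : ℕ) (V : Type*) : Type _ := (Fin (N + 1) → V → V → ℝ) × (Fin (N + 2) → V → ℝ)

/-- A nonnegative flow along the transitions allowed by `A`, with its time marginals. -/
structure IsFlow (A : Fin (N + 1) → Matrix V V ℝ) (p : FlowSpace N V) : Prop where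
  nonneg : ∀ t i j, 0 ≤ p.1 t i j
  supp : ∀ t i j, A t i j = 0 → p.1 t i j = 0
  row : ∀ t i, ∑ j, p.1 t i j = p.2 t.castSucc i
  col : ∀ t j, ∑ i, p.1 t i j = p.2 t.succ j

/-- The relative entropy of a flow with respect to the Markov chain `A`. -/
def flowCost (A : Fin (N + 1) → Matrix V V ℝ) (p : FlowSpace N V) : ℝ :=
  ∑ t, ∑ i, ∑ j, klTerm (p.1 t i j) (p.2 t.castSucc i * A t i j)

/-- The flows whose marginals agree with `ρ` on `S`. -/
def planSet (A : Fin (N + 1) → Matrix V V ℝ) (S : Finset V)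
    (ρ : Fin (N + 2) → {i // i ∈ S} → ℝ) : Set (FlowSpace N V) :=
  {p | IsFlow A p ∧ ∀ t (i : {i // i ∈ S}), p.2 t i = ρ t i}

/-- The chain `A` started at time `t` in the state `i` may visit `S`. -/
inductive Hits (A : Fin (N + 1) → Matrix V V ℝ) (S : Finset V) : Fin (N + 2) → V → Prop
  | obs (t : Fin (N + 2)) (i : V) : i ∈ S → Hits A S t i
  | step (t : Fin (N + 1)) (i j : V) : A t i j ≠ 0 → Hits A S t.succ j → Hits A S t.castSucc i

namespace IsFlow

variable {A : Fin (N + 1) → Matrix V V ℝ} {p q : FlowSpace N V}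

lemma marg_nonneg (hp : IsFlow A p) (t : Fin (N + 2)) (i : V) : 0 ≤ p.2 t i := by
  cases t using Fin.cases with
  | zero =>
    rw [show (0 : Fin (N + 2)) = Fin.castSucc 0 from rfl, ← hp.row]
    exact Finset.sum_nonneg fun j _ => hp.nonneg _ _ _
  | succ t => rw [← hp.col]; exact Finset.sum_nonneg fun j _ => hp.nonneg _ _ _

lemma sum_marg (hp : IsFlow A p) (t : Fin (N + 2)) : ∑ i, p.2 t i = ∑ i, p.2 0 i := by
  induction t using Fin.induction with
  | zero => rfl
  | succ t ih =>
    rw [← ih]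
    simp only [← hp.row, ← hp.col]
    exact Finset.sum_comm

lemma marg_le (hp : IsFlow A p) (t : Fin (N + 2)) (i : V) : p.2 t i ≤ ∑ i, p.2 0 i := by
  rw [← hp.sum_marg t]
  exact Finset.single_le_sum (f := p.2 t) (fun i _ => hp.marg_nonneg t i) (Finset.mem_univ i)

lemma le_marg (hp : IsFlow A p) (t : Fin (N + 1)) (i j : V) :
    p.1 t i j ≤ p.2 t.castSucc i := by
  rw [← hp.row]
  exact Finset.single_le_sum (f := p.1 t i) (fun j _ => hp.nonneg t i j) (Finset.mem_univ j)

lemma domain (hp : IsFlow A p) (t : Fin (N + 1)) (i j : V)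
    (h : p.2 t.castSucc i * A t i j = 0) : p.1 t i j = 0 := by
  rcases mul_eq_zero.1 h with h | h
  · exact le_antisymm (h ▸ hp.le_marg t i j) (hp.nonneg t i j)
  · exact hp.supp t i j h

lemma add (hp : IsFlow A p) (hq : IsFlow A q) : IsFlow A (p + q) where
  nonneg t i j := add_nonneg (hp.nonneg t i j) (hq.nonneg t i j)
  supp t i j h := by simp [hp.supp t i j h, hq.supp t i j h]
  row t i := by simp [Finset.sum_add_distrib, hp.row, hq.row]
  col t i := by simp [Finset.sum_add_distrib, hp.col, hq.col]

lemma smul (hp : IsFlow A p) {c : ℝ} (hc : 0 ≤ c) : IsFlow A (c • p) where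
  nonneg t i j := mul_nonneg hc (hp.nonneg t i j)
  supp t i j h := by simp [hp.supp t i j h]
  row t i := by simp [← Finset.mul_sum, hp.row]
  col t i := by simp [← Finset.mul_sum, hp.col]

end IsFlow

variable {A : Fin (N + 1) → Matrix V V ℝ} {S : Finset V} {ρ : Fin (N + 2) → {i // i ∈ S} → ℝ}

lemma flowCost_smul (c : ℝ) (p : FlowSpace N V) : flowCost A (c • p) = c * flowCost A p := by
  simp only [flowCost, Finset.mul_sum, ← klTerm_mul_mul, Prod.smul_fst, Prod.smul_snd,
    Pi.smul_apply, smul_eq_mul, mul_assoc]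

lemma isClosed_isFlow (A : Fin (N + 1) → Matrix V V ℝ) :
    IsClosed {p : FlowSpace N V | IsFlow A p} := by
  have h : {p : FlowSpace N V | IsFlow A p} =
      {p | ∀ t i j, 0 ≤ p.1 t i j} ∩ {p | ∀ t i j, A t i j = 0 → p.1 t i j = 0} ∩
      {p | ∀ t i, ∑ j, p.1 t i j = p.2 t.castSucc i} ∩
      {p | ∀ t j, ∑ i, p.1 t i j = p.2 t.succ j} := by
    ext p
    exact ⟨fun h => ⟨⟨⟨h.1, h.2⟩, h.3⟩, h.4⟩, fun h => ⟨h.1.1.1, h.1.1.2, h.1.2, h.2⟩⟩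
  rw [h]
  simp only [Set.ofPred_forall]
  refine ((IsClosed.inter ?_ ?_).inter ?_).inter ?_
  · exact isClosed_iInter fun t => isClosed_iInter fun i => isClosed_iInter fun j =>
      isClosed_le (by fun_prop) (by fun_prop)
  · exact isClosed_iInter fun t => isClosed_iInter fun i => isClosed_iInter fun j =>
      isClosed_iInter fun _ => isClosed_eq (by fun_prop) (by fun_prop)
  · exact isClosed_iInter fun t => isClosed_iInter fun i =>
      isClosed_eq (by fun_prop) (by fun_prop)
  · exact isClosed_iInter fun t => isClosed_iInter fun i =>
      isClosed_eq (by fun_prop) (by fun_prop)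

/-- Mass is conserved in time, so the initial mass bounds every entry and every marginal. -/
lemma isCompact_of_sum_le {Q : Set (FlowSpace N V)} (hQ : IsClosed Q) (R : ℝ)
    (h : ∀ p ∈ Q, IsFlow A p ∧ ∑ i, p.2 0 i ≤ R) : IsCompact Q := by
  refine (isCompact_Icc (a := (0 : FlowSpace N V))
    (b := (fun _ _ _ => R, fun _ _ => R))).of_isClosed_subset hQ fun p hp => ?_
  obtain ⟨hf, hR⟩ := h p hp
  exact ⟨⟨fun t i j => hf.nonneg t i j, fun t i => hf.marg_nonneg t i⟩,
    ⟨fun t i j => (hf.le_marg t i j).trans ((hf.marg_le _ i).trans hR),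
      fun t i => (hf.marg_le t i).trans hR⟩⟩

lemma isClosed_planSet (A : Fin (N + 1) → Matrix V V ℝ) (S : Finset V)
    (ρ : Fin (N + 2) → {i // i ∈ S} → ℝ) : IsClosed (planSet A S ρ) := by
  have h : IsClosed {p : FlowSpace N V | ∀ t (i : {i // i ∈ S}), p.2 t i = ρ t i} := by
    simp only [Set.ofPred_forall]
    exact isClosed_iInter fun t => isClosed_iInter fun i =>
      isClosed_eq (by fun_prop) (by fun_prop)
  exact (isClosed_isFlow A).inter h

/-- The unobserved part of the initial marginal. -/
def initProj (N : ℕ) (S : Finset V) : FlowSpace N V →L[ℝ] ({i // i ∉ S} → ℝ) :=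
  ContinuousLinearMap.pi fun i =>
    (ContinuousLinearMap.proj (R := ℝ) (φ := fun _ : V => ℝ) i.1).comp
      ((ContinuousLinearMap.proj (R := ℝ) (φ := fun _ : Fin (N + 2) => V → ℝ) 0).comp
        (ContinuousLinearMap.snd ℝ (Fin (N + 1) → V → V → ℝ) (Fin (N + 2) → V → ℝ)))

omit [Fintype V] in
@[simp] lemma initProj_apply (p : FlowSpace N V) (i : {i // i ∉ S}) :
    initProj N S p i = p.2 0 i := rfl

lemma isCompact_planSet_le (R : ℝ) :
    IsCompact {p ∈ planSet A S ρ | ∀ i, initProj N S p i ≤ R} := by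
  classical
  refine isCompact_of_sum_le (A := A) ?_ (∑ i : V, if h : i ∈ S then ρ 0 ⟨i, h⟩ else R) ?_
  · have h : IsClosed {p : FlowSpace N V | ∀ i, initProj N S p i ≤ R} := by
      simp only [Set.ofPred_forall]
      exact isClosed_iInter fun i => isClosed_le (by fun_prop) (by fun_prop)
    exact (isClosed_planSet A S ρ).inter h
  · rintro p ⟨⟨hf, hobs⟩, hR⟩
    refine ⟨hf, Finset.sum_le_sum fun i _ => ?_⟩
    split_ifs with h
    · exact (hobs 0 ⟨i, h⟩).le
    · exact hR ⟨i, h⟩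

section Stochastic

variable (hA0 : ∀ t i j, 0 ≤ A t i j)
include hA0

lemma IsFlow.prior_nonneg {p : FlowSpace N V} (hp : IsFlow A p) (t : Fin (N + 1)) (i j : V) :
    0 ≤ p.2 t.castSucc i * A t i j := mul_nonneg (hp.marg_nonneg _ _) (hA0 _ _ _)

lemma IsFlow.klTerm_nonneg {p : FlowSpace N V} (hp : IsFlow A p) (t : Fin (N + 1)) (i j : V) :
    0 ≤ klTerm (p.1 t i j) (p.2 t.castSucc i * A t i j) :=
  PartialBridge.klTerm_nonneg (hp.nonneg t i j) (hp.prior_nonneg hA0 t i j) (hp.domain t i j)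

lemma IsFlow.klTerm_add_le {p q : FlowSpace N V} (hp : IsFlow A p) (hq : IsFlow A q)
    (t : Fin (N + 1)) (i j : V) :
    klTerm ((p + q).1 t i j) ((p + q).2 t.castSucc i * A t i j) ≤
      klTerm (p.1 t i j) (p.2 t.castSucc i * A t i j) +
        klTerm (q.1 t i j) (q.2 t.castSucc i * A t i j) := by
  simp only [Prod.fst_add, Prod.snd_add, Pi.add_apply, add_mul]
  exact PartialBridge.klTerm_add_le (hp.nonneg t i j) (hq.nonneg t i j)
    (hp.prior_nonneg hA0 t i j) (hq.prior_nonneg hA0 t i j) (hp.domain t i j) (hq.domain t i j)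

lemma flowCost_nonneg {p : FlowSpace N V} (hp : IsFlow A p) : 0 ≤ flowCost A p :=
  Finset.sum_nonneg fun t _ => Finset.sum_nonneg fun i _ => Finset.sum_nonneg fun j _ =>
    hp.klTerm_nonneg hA0 t i j

lemma flowCost_add_le {p q : FlowSpace N V} (hp : IsFlow A p) (hq : IsFlow A q) :
    flowCost A (p + q) ≤ flowCost A p + flowCost A q := by
  simp only [flowCost, ← Finset.sum_add_distrib]
  exact Finset.sum_le_sum fun t _ => Finset.sum_le_sum fun i _ => Finset.sum_le_sum fun j _ =>
    hp.klTerm_add_le hA0 hq t i j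

/-- Subadditivity together with homogeneity of degree one. -/
lemma convexOn_flowCost : ConvexOn ℝ (planSet A S ρ) (flowCost A) := by
  refine ⟨fun p hp q hq a b ha hb hab => ⟨(hp.1.smul ha).add (hq.1.smul hb), fun t i => ?_⟩,
    fun p hp q hq a b ha hb hab => ?_⟩
  · simp only [Prod.snd_add, Prod.smul_snd, Pi.add_apply, Pi.smul_apply, smul_eq_mul, hp.2, hq.2]
    rw [← add_mul, hab, one_mul]
  · refine (flowCost_add_le hA0 (hp.1.smul ha) (hq.1.smul hb)).trans_eq ?_
    rw [flowCost_smul, flowCost_smul, smul_eq_mul, smul_eq_mul]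

lemma eq_prior_of_flowCost_le_zero {p : FlowSpace N V} (hp : IsFlow A p)
    (h0 : flowCost A p ≤ 0) (t : Fin (N + 1)) (i j : V) :
    p.1 t i j = p.2 t.castSucc i * A t i j := by
  refine eq_of_klTerm_le_zero (hp.nonneg t i j) (hp.prior_nonneg hA0 t i j) (hp.domain t i j)
    (le_trans ?_ h0)
  have n := hp.klTerm_nonneg hA0
  have h1 := Finset.single_le_sum
    (f := fun j => klTerm (p.1 t i j) (p.2 t.castSucc i * A t i j))
    (fun j _ => n t i j) (Finset.mem_univ j)
  have h2 := Finset.single_le_sum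
    (f := fun i => ∑ j, klTerm (p.1 t i j) (p.2 t.castSucc i * A t i j))
    (fun i _ => Finset.sum_nonneg fun j _ => n t i j) (Finset.mem_univ i)
  have h3 := Finset.single_le_sum
    (f := fun t => ∑ i, ∑ j, klTerm (p.1 t i j) (p.2 t.castSucc i * A t i j))
    (fun t _ => Finset.sum_nonneg fun i _ => Finset.sum_nonneg fun j _ => n t i j)
    (Finset.mem_univ t)
  exact h1.trans (h2.trans h3)

/-- A flow of zero cost that misses `S` starts in states from which `S` cannot be visited. -/
lemma IsFlow.eq_zero_of_hits {p : FlowSpace N V} (hp : IsFlow A p)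
    (h0 : flowCost A p ≤ 0) (hS : ∀ t, ∀ i ∈ S, p.2 t i = 0) {t : Fin (N + 2)} {i : V}
    (h : Hits A S t i) : p.2 t i = 0 := by
  induction h with
  | obs t i hi => exact hS t i hi
  | step t i j hij _ ih =>
    rw [← hp.col, Finset.sum_eq_zero_iff_of_nonneg fun i _ => hp.nonneg t i j] at ih
    have h1 := ih i (Finset.mem_univ i)
    rw [eq_prior_of_flowCost_le_zero hA0 hp h0] at h1
    exact (mul_eq_zero.1 h1).resolve_right hij

variable (hA1 : ∀ t i, ∑ j, A t i j = 1)
include hA1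

-- A single term is not jointly continuous where both arguments vanish. Summing over a row collects
-- the logarithms of the marginal into `x log x`, leaving an expression that is continuous
-- everywhere.
omit hA0 in
lemma flowCost_eq {p : FlowSpace N V} (hp : IsFlow A p) :
    flowCost A p = ∑ t, ∑ i, ((∑ j, (p.1 t i j * Real.log (p.1 t i j) -
      p.1 t i j * Real.log (A t i j))) -
        p.2 t.castSucc i * Real.log (p.2 t.castSucc i)) := by
  refine Finset.sum_congr rfl fun t _ => Finset.sum_congr rfl fun i _ => ?_
  have h1 : ∀ j, klTerm (p.1 t i j) (p.2 t.castSucc i * A t i j) =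
      (p.1 t i j * Real.log (p.1 t i j) - p.1 t i j * Real.log (A t i j)) -
        p.1 t i j * Real.log (p.2 t.castSucc i) - p.1 t i j + p.2 t.castSucc i * A t i j := by
    intro j
    by_cases h0 : p.2 t.castSucc i * A t i j = 0
    · rw [hp.domain t i j h0, h0]; simp
    · rw [klTerm_eq_of_pos h0, Real.log_mul (left_ne_zero_of_mul h0) (right_ne_zero_of_mul h0)]
      ring
  simp only [h1, Finset.sum_add_distrib, Finset.sum_sub_distrib, ← Finset.sum_mul,
    ← Finset.mul_sum, hp.row, hA1]
  ring

omit hA0 in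
lemma continuousOn_flowCost : ContinuousOn (flowCost A) {p | IsFlow A p} := by
  refine ContinuousOn.congr (Continuous.continuousOn ?_) fun p hp => flowCost_eq hA1 hp
  have h := Real.continuous_mul_log
  refine continuous_finsetSum _ fun t _ => continuous_finsetSum _ fun i _ => Continuous.sub
    (continuous_finsetSum _ fun j _ => Continuous.sub ?_ ?_) ?_
  · exact h.comp (f := fun p : FlowSpace N V => p.1 t i j) (by fun_prop)
  · fun_prop
  · exact h.comp (f := fun p : FlowSpace N V => p.2 t.castSucc i) (by fun_prop)

open Classical in
/-- The mass that can no longer visit `S` may be assumed to follow the chain, and none need start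
there. -/
lemma exists_flowCost_le {p : FlowSpace N V} (hp : p ∈ planSet A S ρ) :
    ∃ q ∈ planSet A S ρ, flowCost A q ≤ flowCost A p ∧ ∀ i, ¬ Hits A S 0 i → q.2 0 i = 0 := by
  obtain ⟨hf, hobs⟩ := hp
  -- `r` is the new marginal: states that may still reach `S` send out what they did under `p`, all
  -- others move by `A` at zero cost.
  let r : Fin (N + 2) → V → ℝ := Fin.induction (motive := fun _ => V → ℝ)
    (fun i => if Hits A S 0 i then p.2 0 i else 0)
    (fun t r j => ∑ i, if Hits A S t.castSucc i then p.1 t i j else r i * A t i j)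
  have r0 : r 0 = fun i => if Hits A S 0 i then p.2 0 i else 0 := rfl
  have rs : ∀ t : Fin (N + 1), r t.succ = fun j => ∑ i, if Hits A S t.castSucc i then p.1 t i j
      else r t.castSucc i * A t i j := fun t => Fin.induction_succ _ _ t
  -- A state outside `Hits` has no transition into `Hits`, so the modification never affects the
  -- states that matter.
  have hr : ∀ t i, Hits A S t i → r t i = p.2 t i := by
    intro t i h
    cases t using Fin.cases with
    | zero => rw [r0]; exact if_pos h
    | succ t =>
      rw [rs, ← hf.col]
      refine Finset.sum_congr rfl fun k _ => ?_
      split_ifs with hk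
      · rfl
      · have hki : A t k i = 0 := by
          by_contra h0
          exact hk (.step t k i h0 h)
        rw [hki, hf.supp t k i hki, mul_zero]
  have hr0 : ∀ t i, 0 ≤ r t i := by
    intro t
    induction t using Fin.induction with
    | zero =>
      intro i
      rw [r0]
      dsimp only
      split_ifs
      exacts [hf.marg_nonneg 0 i, le_rfl]
    | succ t ih =>
      intro i
      rw [rs]
      refine Finset.sum_nonneg fun k _ => ?_
      split_ifs
      exacts [hf.nonneg t k i, mul_nonneg (ih k) (hA0 t k i)]
  refine ⟨(fun t i j => if Hits A S t.castSucc i then p.1 t i j else r t.castSucc i * A t i j, r),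
    ⟨⟨fun t i j => ?_, fun t i j h => ?_, fun t i => ?_, fun t j => ?_⟩, fun t i => ?_⟩, ?_,
    fun i hi => ?_⟩
  · dsimp only
    split_ifs
    exacts [hf.nonneg t i j, mul_nonneg (hr0 _ i) (hA0 t i j)]
  · dsimp only
    rw [hf.supp t i j h, h, mul_zero, ite_self]
  · dsimp only
    split_ifs with h
    · rw [hf.row, hr _ i h]
    · rw [← Finset.mul_sum, hA1, mul_one]
  · exact (congrFun (rs t) j).symm
  · rw [← hobs]
    exact hr t i (.obs t _ i.2)
  · refine Finset.sum_le_sum fun t _ => Finset.sum_le_sum fun i _ => Finset.sum_le_sum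
      fun j _ => ?_
    dsimp only
    split_ifs with h
    · rw [hr _ i h]
    · rw [klTerm_self]
      exact hf.klTerm_nonneg hA0 t i j
  · dsimp only
    rw [r0]
    exact if_neg hi

/-- The cost controls the mass of the flows that start in states from which `S` may be visited. -/
lemma exists_mass_le : ∃ δ : ℝ, 0 < δ ∧ ∀ p : FlowSpace N V, IsFlow A p →
    (∀ i, ¬ Hits A S 0 i → p.2 0 i = 0) →
      δ * ∑ i, p.2 0 i ≤ flowCost A p + ∑ t, ∑ i ∈ S, p.2 t i := by
  -- The slice of unit mass is compact. On it the right side is positive: zero cost and zero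
  -- observed mass would leave no initial mass. Homogeneity then extends the bound to all masses.
  set Q : Set (FlowSpace N V) :=
    {p | IsFlow A p} ∩ {p | ∑ i, p.2 0 i = 1} ∩ {p | ∀ i, ¬ Hits A S 0 i → p.2 0 i = 0}
  have hQc : IsCompact Q := by
    refine isCompact_of_sum_le (A := A) ?_ 1 fun p hp => ⟨hp.1.1, hp.1.2.le⟩
    refine ((isClosed_isFlow A).inter (isClosed_eq (by fun_prop) (by fun_prop))).inter ?_
    simp only [Set.ofPred_forall]
    exact isClosed_iInter fun i => isClosed_iInter fun _ =>
      isClosed_eq (by fun_prop) (by fun_prop)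
  have hcont : ContinuousOn (fun p => flowCost A p + ∑ t, ∑ i ∈ S, p.2 t i) Q :=
    ((continuousOn_flowCost hA1).mono fun p hp => hp.1.1).add
      (Continuous.continuousOn (by fun_prop))
  have hpos : ∀ p ∈ Q, 0 < flowCost A p + ∑ t, ∑ i ∈ S, p.2 t i := by
    rintro p ⟨⟨hf, hm⟩, hH⟩
    by_contra hcon
    have n1 := flowCost_nonneg hA0 hf
    have n2 : ∀ t, 0 ≤ ∑ i ∈ S, p.2 t i := fun t =>
      Finset.sum_nonneg fun i _ => hf.marg_nonneg t i
    have n3 : 0 ≤ ∑ t, ∑ i ∈ S, p.2 t i := Finset.sum_nonneg fun t _ => n2 t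
    have e3 : ∑ t, ∑ i ∈ S, p.2 t i = 0 := by linarith
    rw [Finset.sum_eq_zero_iff_of_nonneg fun t _ => n2 t] at e3
    have hS : ∀ t, ∀ i ∈ S, p.2 t i = 0 := fun t =>
      (Finset.sum_eq_zero_iff_of_nonneg fun i _ => hf.marg_nonneg t i).1 (e3 t (Finset.mem_univ t))
    have h0 : ∑ i, p.2 0 i = 0 := Finset.sum_eq_zero fun i _ => by
      by_cases h : Hits A S 0 i
      · exact hf.eq_zero_of_hits hA0 (by linarith) hS h
      · exact hH i h
    simp only [Set.mem_ofPred_eq] at hm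
    linarith
  obtain ⟨δ, hδ, hle⟩ : ∃ δ : ℝ, 0 < δ ∧ ∀ p ∈ Q, δ ≤ flowCost A p + ∑ t, ∑ i ∈ S, p.2 t i := by
    rcases Q.eq_empty_or_nonempty with h | h
    · exact ⟨1, one_pos, by simp [h]⟩
    · obtain ⟨p, hp, hmin⟩ := hQc.exists_isMinOn h hcont
      exact ⟨_, hpos p hp, fun q hq => hmin hq⟩
  refine ⟨δ, hδ, fun p hf hH => ?_⟩
  set m := ∑ i, p.2 0 i with hm
  have hm0 : 0 ≤ m := Finset.sum_nonneg fun i _ => hf.marg_nonneg 0 i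
  rcases hm0.eq_or_lt with h | h
  · rw [← h, mul_zero]
    exact add_nonneg (flowCost_nonneg hA0 hf)
      (Finset.sum_nonneg fun t _ => Finset.sum_nonneg fun i _ => hf.marg_nonneg t i)
  · have h1 := hle (m⁻¹ • p) ⟨⟨hf.smul (inv_nonneg.2 hm0), by
      simp [← Finset.mul_sum, ← hm, h.ne']⟩, fun i hi => by simp [hH i hi]⟩
    rw [flowCost_smul] at h1
    simp only [Prod.smul_snd, Pi.smul_apply, smul_eq_mul, ← Finset.mul_sum, ← mul_add] at h1
    rwa [le_inv_mul_iff₀' h] at h1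

/-- The cost attains its minimum over the plans with the given observations. -/
lemma exists_isMinOn_flowCost (hne : (planSet A S ρ).Nonempty) :
    ∃ p ∈ planSet A S ρ, IsMinOn (flowCost A) (planSet A S ρ) p := by
  obtain ⟨p₀, hp₀⟩ := hne
  obtain ⟨δ, hδ, hmass⟩ := exists_mass_le (S := S) hA0 hA1
  -- The observed mass is the same for all plans, so this bounds the mass of every reduced plan that
  -- costs no more than `p₀`.
  set R := (flowCost A p₀ + ∑ t, ∑ i ∈ S, p₀.2 t i) / δ
  have hred : ∀ p ∈ planSet A S ρ, flowCost A p ≤ flowCost A p₀ →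
      ∃ q ∈ {q ∈ planSet A S ρ | ∑ i, q.2 0 i ≤ R}, flowCost A q ≤ flowCost A p := by
    intro p hp hle
    obtain ⟨q, hq, hqp, hH⟩ := exists_flowCost_le hA0 hA1 hp
    refine ⟨q, ⟨hq, ?_⟩, hqp⟩
    have h1 := hmass q hq.1 hH
    have h2 : ∀ t, ∑ i ∈ S, q.2 t i = ∑ i ∈ S, p₀.2 t i := fun t =>
      Finset.sum_congr rfl fun i hi => (hq.2 t ⟨i, hi⟩).trans (hp₀.2 t ⟨i, hi⟩).symm
    simp only [h2] at h1
    rw [le_div_iff₀' hδ]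
    linarith
  have hc : IsCompact {q ∈ planSet A S ρ | ∑ i, q.2 0 i ≤ R} := by
    have h : IsClosed {q : FlowSpace N V | ∑ i, q.2 0 i ≤ R} :=
      isClosed_le (by fun_prop) (by fun_prop)
    exact isCompact_of_sum_le (A := A) ((isClosed_planSet A S ρ).inter h) R
      fun p hp => ⟨hp.1.1, hp.2⟩
  obtain ⟨q₀, hq₀, hq₀le⟩ := hred p₀ hp₀ le_rfl
  obtain ⟨p, hp, hmin⟩ := hc.exists_isMinOn ⟨q₀, hq₀⟩
    ((continuousOn_flowCost hA1).mono fun p hp => hp.1.1)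
  refine ⟨p, hp.1, fun z hz => ?_⟩
  have h0 : flowCost A p ≤ flowCost A q₀ := hmin hq₀
  by_cases hzc : flowCost A z ≤ flowCost A p₀
  · obtain ⟨w, hw, hwz⟩ := hred z hz hzc
    exact (hmin hw : flowCost A p ≤ flowCost A w).trans hwz
  · simp only [Set.mem_ofPred_eq]
    linarith

end Stochastic
end PartialBridge
end

/-! ### Translation between the bridge problem and flows; uniqueness of the plan. -/

noncomputable section
namespace PartialBridge

lemma kl_nonneg {ι : Type*} [Fintype ι] (p q : ι → ℝ) : 0 ≤ kl p q := by
  rw [kl]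
  split_ifs with h
  · exact_mod_cast klVec_nonneg h.1 h.2.1 h.2.2
  · exact le_top

lemma eq_zero_of_klMat_ne_top {ι κ : Type*} [Fintype ι] [Fintype κ] {P Q : Matrix ι κ ℝ}
    (h : klMat P Q ≠ ⊤) {i : ι} {j : κ} (hQ : Q i j = 0) : P i j = 0 := by
  rw [klMat, kl] at h
  split_ifs at h with h0
  · exact h0.2.2 (i, j) hQ
  · exact absurd rfl h

lemma klMat_eq {ι κ : Type*} [Fintype ι] [Fintype κ] {P Q : Matrix ι κ ℝ}
    (hP : ∀ i j, 0 ≤ P i j) (hQ : ∀ i j, 0 ≤ Q i j) (h : ∀ i j, Q i j = 0 → P i j = 0) :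
    klMat P Q = ((∑ i, ∑ j, klTerm (P i j) (Q i j) : ℝ) : EReal) := by
  refine (kl_eq_klVec (fun a : ι × κ => hP a.1 a.2) (fun a => hQ a.1 a.2)
    (fun a => h a.1 a.2)).trans ?_
  rw [klVec, Fintype.sum_prod_type]

/-- Equality in the log-sum inequality with equal weights. -/
lemma eq_of_klTerm_add_le {a b c : ℝ} (ha : 0 ≤ a) (hb : 0 ≤ b)
    (hac : c = 0 → a = 0) (hbc : c = 0 → b = 0)
    (h : klTerm a c + klTerm b c ≤ klTerm (a + b) (c + c)) : a = b := by
  have h1 := klTerm_convexCombo (s := 1 / 2) ha hb (by norm_num) (by norm_num) hac hbc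
  have h2 := klTerm_mul_mul (1 / 2) (a + b) (c + c)
  rw [show (1 : ℝ) / 2 * (c + c) = c by ring,
    show (1 : ℝ) / 2 * (a + b) = (1 - 1 / 2) * a + 1 / 2 * b by ring] at h2
  set m := (1 - 1 / 2) * a + 1 / 2 * b with hm
  have hm0 : 0 ≤ m := by linarith
  have n1 := klTerm_nonneg ha hm0 fun h0 => by linarith
  have n2 := klTerm_nonneg hb hm0 fun h0 => by linarith
  have h3 := eq_of_klTerm_le_zero ha hm0 (fun h0 => by linarith) (by linarith)
  linarith

variable {V : Type*} [Fintype V] {N : ℕ} {A : Fin (N + 1) → Matrix V V ℝ} {S : Finset V}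
  {ρ : Fin (N + 2) → {i // i ∈ S} → ℝ}

/-- The transport plans of a flow, as matrices. -/
def plan (p : FlowSpace N V) : Fin (N + 1) → Matrix V V ℝ := fun t => Matrix.of (p.1 t)

omit [Fintype V] in
lemma plan_apply (p : FlowSpace N V) (t : Fin (N + 1)) (i j : V) : plan p t i j = p.1 t i j := rfl

/-- A plan with given initial marginal is determined by equality in the convexity inequality. -/
lemma eq_of_flowCost_add_ge (hA0 : ∀ t i j, 0 ≤ A t i j) {p q : FlowSpace N V}
    (hp : IsFlow A p) (hq : IsFlow A q) (h0 : p.2 0 = q.2 0)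
    (h : flowCost A p + flowCost A q ≤ flowCost A (p + q)) : p = q := by
  have hle := fun t i j => hp.klTerm_add_le hA0 hq t i j
  have heq : ∀ t i j, klTerm ((p + q).1 t i j) ((p + q).2 t.castSucc i * A t i j) =
      klTerm (p.1 t i j) (p.2 t.castSucc i * A t i j) +
        klTerm (q.1 t i j) (q.2 t.castSucc i * A t i j) := by
    have h1 := le_antisymm (flowCost_add_le hA0 hp hq) h
    simp only [flowCost, ← Finset.sum_add_distrib] at h1
    intro t i j
    have h2 := (Finset.sum_eq_sum_iff_of_le fun t _ => Finset.sum_le_sum fun i _ =>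
      Finset.sum_le_sum fun j _ => hle t i j).1 h1 t (Finset.mem_univ t)
    have h3 := (Finset.sum_eq_sum_iff_of_le fun i _ =>
      Finset.sum_le_sum fun j _ => hle t i j).1 h2 i (Finset.mem_univ i)
    exact (Finset.sum_eq_sum_iff_of_le fun j _ => hle t i j).1 h3 j (Finset.mem_univ j)
  -- Equal marginals give equal priors, for which the log-sum inequality is strict unless the plans
  -- agree; their column sums then give the next marginal.
  have hstep : ∀ t : Fin (N + 1), p.2 t.castSucc = q.2 t.castSucc → p.1 t = q.1 t := by
    intro t ht
    ext i j
    refine eq_of_klTerm_add_le (hp.nonneg t i j) (hq.nonneg t i j) (hp.domain t i j)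
      (by rw [ht]; exact hq.domain t i j) ?_
    have := heq t i j
    simp only [Prod.fst_add, Prod.snd_add, Pi.add_apply, ← ht, add_mul] at this
    exact this.ge
  have hmarg : ∀ t, p.2 t = q.2 t := by
    intro t
    induction t using Fin.induction with
    | zero => exact h0
    | succ t ih =>
      ext j
      rw [← hp.col, ← hq.col, hstep t ih]
  exact Prod.ext (funext fun t => hstep t (hmarg _)) (funext hmarg)

/-- The chain rule for the divergence from a reference chain with initial distribution `μ`. -/
lemma sum_klTerm_initial (hA1 : ∀ t i, ∑ j, A t i j = 1) {p : FlowSpace N V} (hp : IsFlow A p)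
    {μ : V → ℝ} (hμ : ∀ i, μ i = 0 → p.2 0 i = 0) :
    ∑ i, ∑ j, klTerm (p.1 0 i j) (μ i * A 0 i j) =
      ∑ i, ∑ j, klTerm (p.1 0 i j) (p.2 0 i * A 0 i j) + klVec (p.2 0) μ := by
  rw [klVec, ← Finset.sum_add_distrib]
  refine Finset.sum_congr rfl fun i _ => ?_
  have h : ∀ j, klTerm (p.1 0 i j) (μ i * A 0 i j) = klTerm (p.1 0 i j) (p.2 0 i * A 0 i j) +
      p.1 0 i j * Real.log (p.2 0 i / μ i) - p.2 0 i * A 0 i j + μ i * A 0 i j := by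
    intro j
    by_cases h0 : p.1 0 i j = 0
    · simp [h0]
    · have h1 : p.2 0 i * A 0 i j ≠ 0 := fun h1 => h0 (hp.domain 0 i j h1)
      have h2 := left_ne_zero_of_mul h1
      have h3 := right_ne_zero_of_mul h1
      have h4 : μ i ≠ 0 := fun h4 => h2 (hμ i h4)
      rw [klTerm_eq_of_pos h1, klTerm_eq_of_pos (mul_ne_zero h4 h3), Real.log_div h2 h4,
        Real.log_mul h2 h3, Real.log_mul h4 h3]
      ring
  have hrow : ∑ j, p.1 0 i j = p.2 0 i := hp.row 0 i
  rw [Finset.sum_congr rfl fun j _ => h j]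
  simp only [Finset.sum_add_distrib, Finset.sum_sub_distrib, ← Finset.sum_mul,
    ← Finset.mul_sum, hA1, hrow]
  rw [klTerm]
  ring

variable [DecidableEq V]

lemma obsMatrix_mulVec (S : Finset V) (v : V → ℝ) (i : {i // i ∈ S}) :
    (obsMatrix S *ᵥ v) i = v i := by
  simp [obsMatrix, Matrix.mulVec, dotProduct]

lemma unobsMatrix_mulVec (S : Finset V) (v : V → ℝ) (i : {i // i ∉ S}) :
    (unobsMatrix S *ᵥ v) i = v i := by
  simp [unobsMatrix, Matrix.mulVec, dotProduct]

lemma mulVec_one_apply {ι κ : Type*} [Fintype κ] (M : Matrix ι κ ℝ) (i : ι) :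
    (M *ᵥ 1) i = ∑ j, M i j := by
  simp [Matrix.mulVec, dotProduct]

lemma initMass_mem (S : Finset V) (ρ₀ : {i // i ∈ S} → ℝ) (η : {i // i ∉ S} → ℝ)
    (i : {i // i ∈ S}) : initMass S ρ₀ η i = ρ₀ i := by
  have h : ∀ j : {i // i ∉ S}, j.1 ≠ i.1 := fun j h => j.2 (h ▸ i.2)
  simp [initMass, obsMatrix, unobsMatrix, Matrix.mulVec, dotProduct, h]

lemma initMass_notMem (S : Finset V) (ρ₀ : {i // i ∈ S} → ℝ) (η : {i // i ∉ S} → ℝ)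
    (i : {i // i ∉ S}) : initMass S ρ₀ η i = η i := by
  have h : ∀ j : {i // i ∈ S}, j.1 ≠ i.1 := fun j h => i.2 (h ▸ j.2)
  simp [initMass, obsMatrix, unobsMatrix, Matrix.mulVec, dotProduct, h, Subtype.coe_inj]

lemma isFeasible_of_mem_planSet {p : FlowSpace N V} (hp : p ∈ planSet A S ρ) :
    IsFeasible S ρ (plan p) where
  nonneg := hp.1.nonneg
  obs t := by
    ext i
    rw [obsMatrix_mulVec, mulVec_one_apply]
    exact (hp.1.row t i).trans (hp.2 _ i)
  obs_last := by
    ext i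
    rw [obsMatrix_mulVec, mulVec_one_apply]
    exact (hp.1.col (Fin.last N) i).trans (hp.2 _ i)
  matching t := by
    ext i
    rw [mulVec_one_apply, mulVec_one_apply]
    exact (hp.1.row t.succ i).trans (hp.1.col t.castSucc i).symm

lemma IsFeasible.exists_mem_planSet {M : Fin (N + 1) → Matrix V V ℝ} (hM : IsFeasible S ρ M)
    (hsupp : ∀ t i j, A t i j = 0 → M t i j = 0) : ∃ p ∈ planSet A S ρ, plan p = M := by
  -- Row sums at time 0, column sums of the preceding plan afterwards; mass matching identifies them
  -- with the later row sums.
  let r : Fin (N + 2) → V → ℝ := Fin.cases (M 0 *ᵥ 1) fun t => (M t)ᵀ *ᵥ 1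
  have hr : ∀ t : Fin (N + 1), r t.castSucc = M t *ᵥ 1 := by
    intro t
    cases t using Fin.cases with
    | zero => rfl
    | succ t => exact (hM.matching t).symm
  refine ⟨(fun t i j => M t i j, r),
    ⟨⟨hM.nonneg, hsupp, fun t i => ?_, fun t j => ?_⟩, fun t i => ?_⟩, rfl⟩
  · exact (mulVec_one_apply (M t) i).symm.trans (congrFun (hr t) i).symm
  · exact (mulVec_one_apply (M t)ᵀ j).symm
  · cases t using Fin.lastCases with
    | last => exact (obsMatrix_mulVec S _ i).symm.trans (congrFun hM.obs_last i)
    | cast t =>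
      dsimp only
      rw [hr, ← hM.obs t, obsMatrix_mulVec]

lemma unobsInit_eq {p : FlowSpace N V} (hp : IsFlow A p) : unobsInit S (plan p) = initProj N S p := by
  ext i
  rw [unobsInit, unobsMatrix_mulVec, mulVec_one_apply, initProj_apply]
  exact hp.row 0 i

/-- The chain rule; the observed coordinates drop out since plan and prior agree there. It serves
both for `η` equal to the plan's own marginal, where the divergence vanishes, and for positive `η`.
-/
lemma bridgeCost_eq (hA0 : ∀ t i j, 0 ≤ A t i j) (hA1 : ∀ t i, ∑ j, A t i j = 1)
    {p : FlowSpace N V} (hp : p ∈ planSet A S ρ) {η : {i // i ∉ S} → ℝ} (hη : 0 ≤ η)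
    (h : ∀ i, η i = 0 → p.2 0 i.1 = 0) :
    bridgeCost A (initMass S (ρ 0) η) (plan p) =
      ((flowCost A p + klVec (initProj N S p) η : ℝ) : EReal) := by
  obtain ⟨hf, hobs⟩ := hp
  set μ := initMass S (ρ 0) η with hμ
  have hcase : ∀ i, (0 ≤ μ i) ∧ (μ i = 0 → p.2 0 i = 0) := by
    intro i
    by_cases hi : i ∈ S
    · have : μ i = p.2 0 i := (initMass_mem S (ρ 0) η ⟨i, hi⟩).trans (hobs 0 ⟨i, hi⟩).symm
      exact ⟨this ▸ hf.marg_nonneg 0 i, fun h => this ▸ h⟩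
    · have : μ i = η ⟨i, hi⟩ := initMass_notMem S (ρ 0) η ⟨i, hi⟩
      exact ⟨this ▸ hη ⟨i, hi⟩, fun h0 => h ⟨i, hi⟩ (this ▸ h0)⟩
  have hdiag : ∀ t, plan p t *ᵥ 1 = p.2 t.castSucc := fun t => by
    ext i
    rw [mulVec_one_apply]
    exact hf.row t i
  have hle : ∀ i j, p.1 0 i j ≤ p.2 0 i := fun i j => hf.le_marg 0 i j
  have h1 : klMat (plan p 0) (diagonal μ * A 0) =
      ((∑ i, ∑ j, klTerm (p.1 0 i j) (μ i * A 0 i j) : ℝ) : EReal) := by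
    rw [klMat_eq (P := plan p 0) (hf.nonneg 0)]
    · simp only [Matrix.diagonal_mul, plan_apply]
    · intro i j
      rw [Matrix.diagonal_mul]
      exact mul_nonneg (hcase i).1 (hA0 0 i j)
    · intro i j h0
      rw [Matrix.diagonal_mul] at h0
      rcases mul_eq_zero.1 h0 with h0 | h0
      · exact le_antisymm ((hle i j).trans_eq ((hcase i).2 h0)) (hf.nonneg 0 i j)
      · exact hf.supp 0 i j h0
  have h2 : ∀ t : Fin N, klMat (plan p t.succ) (diagonal (plan p t.succ *ᵥ 1) *
      A t.succ) = ((∑ i, ∑ j, klTerm (p.1 t.succ i j)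
        (p.2 t.succ.castSucc i * A t.succ i j) : ℝ) : EReal) := by
    intro t
    rw [hdiag, klMat_eq (P := plan p t.succ) (hf.nonneg t.succ)]
    · simp only [Matrix.diagonal_mul, plan_apply]
    · intro i j
      rw [Matrix.diagonal_mul]
      exact hf.prior_nonneg hA0 t.succ i j
    · intro i j h0
      rw [Matrix.diagonal_mul] at h0
      exact hf.domain t.succ i j h0
  have h3 : klVec (p.2 0) μ = klVec (initProj N S p) η := by
    rw [klVec, ← Fintype.sum_subtype_add_sum_subtype (fun i => i ∈ S), klVec]
    have e1 : ∀ i : {i // i ∈ S}, klTerm (p.2 0 i) (μ i) = 0 := fun i => by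
      rw [hμ, initMass_mem, hobs, klTerm_self]
    have e2 : ∀ i : {i // i ∉ S}, klTerm (p.2 0 i) (μ i) = klTerm (initProj N S p i) (η i) :=
      fun i => by rw [hμ, initMass_notMem, initProj_apply]
    simp only [e1, e2, Finset.sum_const_zero, zero_add]
  rw [bridgeCost, h1, Finset.sum_congr rfl fun t _ => h2 t, ← h3,
    sum_klTerm_initial hA1 hf fun i => (hcase i).2, flowCost, Fin.sum_univ_succ]
  have h4 : ∀ (u : Fin N → ℝ), ∑ t, ((u t : ℝ) : EReal) = ((∑ t, u t : ℝ) : EReal) :=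
    fun u => (map_sum (⟨⟨Real.toEReal, rfl⟩, EReal.coe_add⟩ : ℝ →+ EReal) u _).symm
  rw [h4, ← EReal.coe_add]
  congr 1
  simp only [Fin.castSucc_zero]
  ring

/-- All summands are nonnegative, so a finite total makes each finite, and a vanishing transition
makes its prior vanish. -/
lemma supp_of_bridgeCost_ne_top {μ : V → ℝ} {M : Fin (N + 1) → Matrix V V ℝ}
    (h : bridgeCost A μ M ≠ ⊤) (t : Fin (N + 1)) (i j : V) (h0 : A t i j = 0) : M t i j = 0 := by
  have n : ∀ t ∈ Finset.univ,
      0 ≤ klMat (M (Fin.succ t)) (diagonal (M t.succ *ᵥ 1) * A t.succ) := fun t _ => kl_nonneg _ _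
  have key : klMat (M t) (diagonal (Fin.cases μ (fun t : Fin N => M t.succ *ᵥ 1) t) * A t) ≠ ⊤ := by
    refine ne_top_of_le_ne_top h ?_
    cases t using Fin.cases with
    | zero => exact le_add_of_nonneg_right (Finset.sum_nonneg n)
    | succ t =>
      exact (Finset.single_le_sum n (Finset.mem_univ t)).trans
        (le_add_of_nonneg_left (kl_nonneg _ _))
  refine eq_zero_of_klMat_ne_top key ?_
  rw [Matrix.diagonal_mul, h0, mul_zero]

lemma bridgeCost_initMass_unobsInit {M : Fin (N + 1) → Matrix V V ℝ} (hM : IsFeasible S ρ M) :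
    bridgeCost A (initMass S (ρ 0) (unobsInit S M)) M = primalCost A M := by
  have h : initMass S (ρ 0) (unobsInit S M) = M 0 *ᵥ 1 := by
    ext i
    by_cases hi : i ∈ S
    · have h1 := congrFun (hM.obs 0) ⟨i, hi⟩
      rw [obsMatrix_mulVec] at h1
      exact (initMass_mem S _ _ ⟨i, hi⟩).trans h1.symm
    · refine (initMass_notMem S _ _ ⟨i, hi⟩).trans ?_
      rw [unobsInit, unobsMatrix_mulVec]
  rw [bridgeCost, h, primalCost, Fin.sum_univ_succ]

lemma isFiberMin_valueFun (hA0 : ∀ t i j, 0 ≤ A t i j) (hA1 : ∀ t i, ∑ j, A t i j = 1)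
    (hreg : Regular A S ρ) :
    IsFiberMin (planSet A S ρ) (flowCost A) (initProj N S) (valueFun A S ρ) := by
  have hcost : ∀ p ∈ planSet A S ρ,
      bridgeCost A (initMass S (ρ 0) (initProj N S p)) (plan p) = (flowCost A p : ℝ) := by
    intro p hp
    rw [bridgeCost_eq hA0 hA1 hp (η := initProj N S p) (fun i => hp.1.marg_nonneg 0 i) fun i h => h, klVec_self,
      add_zero]
  have hle : ∀ p ∈ planSet A S ρ, valueFun A S ρ (initProj N S p) ≤ flowCost A p := by
    intro p hp
    rw [← hcost p hp]
    exact iInf_le_of_le (plan p) (iInf_le_of_le (isFeasible_of_mem_planSet hp)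
      (iInf_le_of_le (unobsInit_eq hp.1) le_rfl))
  refine ⟨isCompact_planSet_le, convexOn_flowCost hA0,
    (continuousOn_flowCost hA1).mono fun p hp => hp.1, fun p hp => flowCost_nonneg hA0 hp.1,
    fun p hp i => hp.1.marg_nonneg 0 i, ?_, hle, fun η hη => ?_⟩
  · obtain ⟨M, hM, hfin, hpos⟩ := hreg
    rw [← bridgeCost_initMass_unobsInit hM] at hfin
    obtain ⟨p, hp, rfl⟩ := hM.exists_mem_planSet (supp_of_bridgeCost_ne_top hfin)
    refine ⟨p, hp, fun i => ?_⟩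
    -- Each row of `A 0` sums to 1 and so has a positive entry; regularity puts mass there, hence on
    -- every unobserved initial state.
    obtain ⟨j, -, hj⟩ := Finset.exists_ne_zero_of_sum_ne_zero
      ((hA1 0 i.1).trans_ne one_ne_zero)
    exact (hpos 0 i j ((hA0 0 i j).lt_of_ne' hj)).trans_le (hp.1.le_marg 0 i j)
  · have hex : ∀ M, IsFeasible S ρ M → unobsInit S M = η →
        bridgeCost A (initMass S (ρ 0) η) M ≠ ⊤ → ∃ p ∈ planSet A S ρ, plan p = M ∧
          initProj N S p = η := by
      intro M hM hMη hfin
      obtain ⟨p, hp, rfl⟩ := hM.exists_mem_planSet (supp_of_bridgeCost_ne_top hfin)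
      exact ⟨p, hp, rfl, (unobsInit_eq hp.1).symm.trans hMη⟩
    have hc : IsCompact {p ∈ planSet A S ρ | initProj N S p = η} := by
      have h1 : IsClosed {p : FlowSpace N V | initProj N S p = η} :=
        isClosed_eq (by fun_prop) (by fun_prop)
      refine (isCompact_planSet_le (A := A) (S := S) (ρ := ρ) ‖η‖).of_isClosed_subset
        ((isClosed_planSet A S ρ).inter h1) ?_
      rintro p ⟨hp, rfl⟩
      exact ⟨hp, fun i => (le_abs_self _).trans (norm_le_pi_norm (initProj N S p) i)⟩
    obtain ⟨p₀, hp₀⟩ : {p ∈ planSet A S ρ | initProj N S p = η}.Nonempty := by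
      by_contra hne
      refine hη (iInf_eq_top.2 fun M => iInf_eq_top.2 fun hM => iInf_eq_top.2 fun hMη => ?_)
      by_contra hfin
      obtain ⟨p, hp, -, hpη⟩ := hex M hM hMη hfin
      exact hne ⟨p, hp, hpη⟩
    obtain ⟨p, ⟨hp, hpη⟩, hmin⟩ := hc.exists_isMinOn ⟨p₀, hp₀⟩
      ((continuousOn_flowCost hA1).mono fun p hp => hp.1.1)
    refine ⟨p, hp, hpη, le_antisymm (hpη ▸ hle p hp) ?_⟩
    refine le_iInf fun M => le_iInf fun hM => le_iInf fun hMη => ?_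
    by_cases hfin : bridgeCost A (initMass S (ρ 0) η) M = ⊤
    · rw [hfin]; exact le_top
    · obtain ⟨q, hq, rfl, rfl⟩ := hex M hM hMη hfin
      rw [hcost q hq]
      exact_mod_cast (hmin ⟨hq, rfl⟩ : flowCost A p ≤ flowCost A q)

lemma solvesFixedPrior_iff (hA0 : ∀ t i j, 0 ≤ A t i j) (hA1 : ∀ t i, ∑ j, A t i j = 1)
    (hne : (planSet A S ρ).Nonempty) {η : {i // i ∉ S} → ℝ} (hη : ∀ i, 0 < η i)
    {M : Fin (N + 1) → Matrix V V ℝ} :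
    SolvesFixedPrior A S ρ η M ↔ ∃ p ∈ planSet A S ρ, plan p = M ∧
      IsMinOn (proxObj (flowCost A) (initProj N S) 1 η) (planSet A S ρ) p := by
  have hcost : ∀ p ∈ planSet A S ρ, bridgeCost A (initMass S (ρ 0) η) (plan p) =
      (proxObj (flowCost A) (initProj N S) 1 η p : ℝ) := by
    intro p hp
    rw [bridgeCost_eq hA0 hA1 hp (fun i => (hη i).le) fun i h => absurd h (hη i).ne', proxObj,
      one_mul]
  constructor
  · rintro ⟨hM, hmin⟩
    obtain ⟨p₀, hp₀⟩ := hne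
    have hfin : bridgeCost A (initMass S (ρ 0) η) M ≠ ⊤ := by
      refine ne_top_of_le_ne_top ?_ (hmin _ (isFeasible_of_mem_planSet hp₀))
      rw [hcost p₀ hp₀]
      exact EReal.coe_ne_top _
    obtain ⟨p, hp, rfl⟩ := hM.exists_mem_planSet (supp_of_bridgeCost_ne_top hfin)
    refine ⟨p, hp, rfl, fun q hq => ?_⟩
    have h1 := hmin _ (isFeasible_of_mem_planSet hq)
    rw [hcost p hp, hcost q hq] at h1
    exact_mod_cast h1
  · rintro ⟨p, hp, rfl, hmin⟩
    refine ⟨isFeasible_of_mem_planSet hp, fun M' hM' => ?_⟩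
    by_cases hfin : bridgeCost A (initMass S (ρ 0) η) M' = ⊤
    · rw [hfin]; exact le_top
    · obtain ⟨q, hq, rfl⟩ := hM'.exists_mem_planSet (supp_of_bridgeCost_ne_top hfin)
      rw [hcost p hp, hcost q hq]
      exact_mod_cast (hmin hq : proxObj _ _ _ _ p ≤ proxObj _ _ _ _ q)

/-- Both minimizers have the same unobserved initial part, so the full initial marginals coincide.
Minimality against the midpoint forces equality in subadditivity of `flowCost`. -/
lemma eq_of_isMinOn_proxObj (hA0 : ∀ t i j, 0 ≤ A t i j)
    (H : IsFiberMin (planSet A S ρ) (flowCost A) (initProj N S) (valueFun A S ρ))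
    {ε : ℝ} (hε : 0 < ε) {y : {i // i ∉ S} → ℝ} (hy : ∀ i, 0 < y i) {p q : FlowSpace N V}
    (hp : p ∈ planSet A S ρ) (hq : q ∈ planSet A S ρ)
    (hpm : IsMinOn (proxObj (flowCost A) (initProj N S) ε y) (planSet A S ρ) p)
    (hqm : IsMinOn (proxObj (flowCost A) (initProj N S) ε y) (planSet A S ρ) q) : p = q := by
  have hL := H.map_eq hε hy hp hpm hq hqm
  have h0 : p.2 0 = q.2 0 := by
    ext i
    by_cases hi : i ∈ S
    · exact (hp.2 0 ⟨i, hi⟩).trans (hq.2 0 ⟨i, hi⟩).symm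
    · exact (congrFun hL ⟨i, hi⟩).symm
  refine eq_of_flowCost_add_ge hA0 hp.1 hq.1 h0 ?_
  have hmid : (1 - 1 / 2 : ℝ) • p + (1 / 2 : ℝ) • q = (1 / 2 : ℝ) • (p + q) := by
    rw [smul_add]; norm_num
  have h1 := H.combo_mem hp hq (s := 1 / 2) (by norm_num) (by norm_num)
  rw [hmid] at h1
  have h2 : initProj N S ((1 / 2 : ℝ) • (p + q)) = initProj N S p := by
    rw [map_smul, map_add, hL, ← two_smul ℝ, smul_smul]; norm_num
  have h3 : proxObj (flowCost A) (initProj N S) ε y p ≤ _ := hpm h1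
  have h4 : proxObj (flowCost A) (initProj N S) ε y q ≤ _ := hqm h1
  rw [proxObj, proxObj, h2, flowCost_smul] at h3 h4
  rw [hL] at h4
  linarith

end PartialBridge
end

/-! ### The proposition. -/

theorem mainTheorem6 {V : Type*} [Fintype V] [DecidableEq V] {N : ℕ}
    (A : Fin (N + 1) → Matrix V V ℝ) (hA : ∀ t, A t ∈ Matrix.rowStochastic ℝ V)
    (S : Finset V) (ρ : Fin (N + 2) → {i // i ∈ S} → ℝ)
    (hreg : PartialBridge.Regular A S ρ) :
    (∀ (ε : ℕ → ℝ) (x₀ : {i // i ∉ S} → ℝ), (∀ k, 0 < ε k) → (∀ i, 0 < x₀ i) →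
      (∃! x, PartialBridge.IsProxSequence (PartialBridge.valueFun A S ρ) ε x₀ x) ∧
      ∀ x, PartialBridge.IsProxSequence (PartialBridge.valueFun A S ρ) ε x₀ x →
        (∀ k i, 0 < x k i) ∧
        (¬ Summable (fun k => 1 / ε k) →
          ∃ ηstar, PartialBridge.valueFun A S ρ ηstar ≠ ⊤ ∧
            (∀ η, PartialBridge.valueFun A S ρ ηstar ≤ PartialBridge.valueFun A S ρ η) ∧
            Tendsto x atTop (𝓝 ηstar))) ∧
    (∀ ηhat : {i // i ∉ S} → ℝ, (∀ i, 0 < ηhat i) →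
      (∃! M, PartialBridge.SolvesFixedPrior A S ρ ηhat M) ∧
      ∀ M, PartialBridge.SolvesFixedPrior A S ρ ηhat M →
        PartialBridge.entropicProx (PartialBridge.valueFun A S ρ) 1 ηhat =
          {PartialBridge.unobsInit S M}) := by
  have hA0 : ∀ t i j, 0 ≤ A t i j := fun t => (hA t).1
  have hA1 : ∀ t i, ∑ j, A t i j = 1 := fun t => Matrix.sum_row_of_mem_rowStochastic (hA t)
  have H := PartialBridge.isFiberMin_valueFun hA0 hA1 hreg
  have hne : (PartialBridge.planSet A S ρ).Nonempty :=
    let ⟨p, hp, _⟩ := H.exists_pos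
    ⟨p, hp⟩
  refine ⟨fun ε x₀ hε h₀ => ⟨H.existsUnique_proxSequence hε h₀, fun x hx =>
    ⟨H.proxSequence_pos hε h₀ hx, H.tendsto_proxSequence hε h₀
      (PartialBridge.exists_isMinOn_flowCost hA0 hA1 hne) hx⟩⟩, fun η hη => ⟨?_, fun M hM => ?_⟩⟩
  · obtain ⟨p, hp, hmin⟩ := H.exists_isMinOn one_pos hη
    refine ⟨PartialBridge.plan p,
      (PartialBridge.solvesFixedPrior_iff hA0 hA1 hne hη).2 ⟨p, hp, rfl, hmin⟩, fun M hM => ?_⟩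
    obtain ⟨q, hq, rfl, hqmin⟩ := (PartialBridge.solvesFixedPrior_iff hA0 hA1 hne hη).1 hM
    rw [PartialBridge.eq_of_isMinOn_proxObj hA0 H one_pos hη hq hp hqmin hmin]
  · obtain ⟨p, hp, rfl, hmin⟩ := (PartialBridge.solvesFixedPrior_iff hA0 hA1 hne hη).1 hM
    rw [PartialBridge.unobsInit_eq hp.1]
    refine Set.eq_singleton_iff_nonempty_unique_mem.2
      ⟨(H.existsUnique_step one_pos hη).exists, fun x hx => ?_⟩
    obtain ⟨v, hv, rfl, -, hvmin⟩ := (H.mem_entropicProx_iff hη).1 hx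
    exact H.map_eq one_pos hη hp hmin hv hvmin
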